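/- **Setting.** Let $[d]=\{1,\dots,d\}$, and let $f:[-1,1]^d\to\mathbb R$ be of the form $$f(\mathbf x)=\mu+\sum_{p\in S_1}\phi_p(x_p)+\sum_{\mathbf j=(j_1,j_2)\in S_2}\phi_{\mathbf j}(x_{j_1},x_{j_2})+\sum_{l\in S_2^{(1)}}\phi_l(x_l),$$ where $S_1\subseteq[d]$, $S_2\subseteq\binom{[d]}{2}=\{(j_1,j_2):1\le j_1<j_2\le d\}$, $S_2^{(1)}$ is the set of all coordinates occurring in a pair of $S_2$, $S_1\cap S_2^{(1)}=\emptyset$, $\phi_p(0)=0$ for $p\in S_1\cup S_2^{(1)}$, and, for $\mathbf j\in S_2$, $\phi_{\mathbf j}(x_{j_1},x_{j_2})=0$ if $x_{j_1}=0$ or $x_{j_2}=0$. Let $L>0$, $\alpha\in(0,1]$, $D_1,D_2>0$. Assume that all components are Hölder continuous on $[-1,1]$, resp. $[-1,1]^2$: $|\phi(\mathbf s)-\phi(\mathbf t)|\le L\|\mathbf s-\mathbf t\|_2^\alpha$; that for each $p\in S_1$ there is $t\in[-1,1]$ with $|\phi_p(t)|>D_1$; and that for each $\mathbf j\in S_2$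 there is $\mathbf t\in[-1,1]^2$ with $|\phi_{\mathbf j}(\mathbf t)|>D_2$. Querying $f$ at $\mathbf x$ returns $f(\mathbf x)+\eta$, with arbitrary noise $|\eta|\le\varepsilon$ in each query. **Algorithm.** Let $\mathcal H$ be a $(d,2)$ hash family: a finite family of maps $h:[d]\to\{1,2\}$ such that for any two distinct coordinates some $h\in\mathcal H$ takes different values at them. Let $G_m=\{-1,-\frac{m-1}{m},\dots,\frac{m-1}{m},1\}$. *Stage 2 (estimation of $S_2$).* Draw independent uniform $\beta_1,\dots,\beta_{n_2}\in\{-1,1\}^d$, and let $B\in\mathbb R^{n_2\times\binom d2}$ have the entries $B_{i,\mathbf j}=\beta_{i,j_1}\beta_{i,j_2}$. For every $h\in\mathcal H$ and $(c_1,c_2)\in G_{m_2}^2$, let $x_q=c_{h(q)}$ for $q\in[d]$. For every $i\le n_2$ and $s\in\{-1,1\}^2$, query $f$ at the point $\mathbf x_{i,s}$ whose $q$-th coordinate is $x_q$ if $s_{h(q)}\beta_{i,q}=1$, and $0$ otherwise. Let $y_i$ be the sum over $s$ of $s_1s_2$ times the answer at $\mathbf x_{i,s}$. Let $\hat z$ be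 a solution of $$(P2)\qquad \min\|z\|_1\quad\text{s.t.}\quad\|y-Bz\|_1\le 4\varepsilon n_2,$$ and add to $\hat S_2$ (initially empty) all pairs $\mathbf j$ with $h(j_1)\ne h(j_2)$ and $|\hat z_{\mathbf j}|>\epsilon_2$. *Stage 1 (estimation of $S_1$).* Let $P=[d]\setminus\hat S_2^{(1)}$, where $\hat S_2^{(1)}$ is the set of the coordinates occurring in $\hat S_2$. Draw independent uniform $\gamma_1,\dots,\gamma_{n_1}\in\{-1,1\}^P$, and let $B\in\mathbb R^{n_1\times P}$ be the matrix with these rows. For every $c\in G_{m_1}$ and $i\le n_1$, query $f$ at the points $\mathbf x_i^{\pm}$ whose $q$-th coordinate is $c$ if $q\in P$ and $\gamma_{i,q}=\pm1$, and $0$ otherwise, and let $y_i$ be the difference of the two answers. Let $\hat z$ be a solution of $$(P1)\qquad \min\|z\|_1\quad\text{s.t.}\quad\|y-Bz\|_2\le 2\varepsilon\sqrt{n_1},$$ and add to $\hat S_1$ (initially empty) all $p\in P$ with $|\hat z_p|>\epsilon_1$. (If a program has no solution, $\hat z$ is arbitrary.) **Theorem.** There are absolute constants $C_2,C_4,\tilde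 c_1,\tilde c_2,\tilde c_3,\tilde c_4,\kappa,K>0$, and numbers $\bar c_i=\bar c_i(L,D_i,\alpha)>1$ ($i=1,2$), such that the following holds for all $d$ and all $f$ as above. Put $$X_2=|S_2|\log\frac{d^2}{|S_2|},\qquad X_1=|S_1|\log\max\Bigl\{2,\frac{d-|S_2^{(1)}|}{|S_1|}\Bigr\}$$ ($X_i=0$ if $S_i=\emptyset$), and let $\epsilon_2=4C_4\varepsilon$ and $\epsilon_1=2C_2\varepsilon$. If $$0\le\varepsilon<\min\Bigl\{\frac{D_2}{12C_4},\frac{D_1}{6C_2}\Bigr\},\quad m_2\ge\sqrt2\Bigl(\frac{3L}{D_2}\Bigr)^{1/\alpha},\quad n_2\ge\tilde c_3X_2,\quad m_1\ge\Bigl(\frac{3L}{D_1}\Bigr)^{1/\alpha},\quad n_1\ge\tilde c_1X_1,$$ then $\hat S_2=S_2$ and $\hat S_1=S_1$ with probability at least $$1-\exp(-\tilde c_4n_2)-2\exp(-\tilde c_2n_1).$$ Every run makes exactly $Q=4(2m_2+1)^2n_2|\mathcal H|+2(2m_1+1)n_1$ queries. Moreover, $$Q\ge\kappa\,(\bar c_2X_2|\mathcal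 H|+\bar c_1X_1),$$ and if $m_1,m_2,n_1,n_2$ are the smallest non-negative integers that satisfy the conditions above, then also $$Q\le K\,(\bar c_2X_2|\mathcal H|+\bar c_1X_1).$$ -/

import Mathlib

namespace SPAM

/-- Ordered pairs `j = (j₁, j₂)` with `j₁ < j₂` of coordinates. -/
abbrev Pair (d : ℕ) : Type := {j : Fin d × Fin d // j.1 < j.2}

/-- The domain `[-1, 1]^d`. -/
def cube (d : ℕ) : Set (Fin d → ℝ) := {x | ∀ q, x q ∈ Set.Icc (-1 : ℝ) 1}

/-- The set of all coordinates that occur in some pair of `S₂`. -/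
def pairVars {d : ℕ} (S₂ : Finset (Pair d)) : Finset (Fin d) :=
  S₂.image (fun j => j.1.1) ∪ S₂.image (fun j => j.1.2)

/-- A bivariate sparse additive model in its anchored normal form: a constant, univariate
components `φ₁ p` for `p ∈ S₁ ∪ pairVars S₂`, and bivariate components `φ₂ j` for `j ∈ S₂`,
where `S₁` does not meet `pairVars S₂`. Components with other indices play no role. -/
structure BivariateSPAM (d : ℕ) where
  S₁ : Finset (Fin d)
  S₂ : Finset (Pair d)
  disjoint : Disjoint S₁ (pairVars S₂)
  mean : ℝ
  φ₁ : Fin d → ℝ → ℝ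
  φ₂ : Pair d → ℝ → ℝ → ℝ
  anchor₁ : ∀ p ∈ S₁ ∪ pairVars S₂, φ₁ p 0 = 0
  anchor₂ : ∀ j ∈ S₂, ∀ t ∈ Set.Icc (-1 : ℝ) 1, φ₂ j t 0 = 0 ∧ φ₂ j 0 t = 0

namespace BivariateSPAM

variable {d : ℕ}

/-- The function described by the model. -/
def eval (M : BivariateSPAM d) (x : Fin d → ℝ) : ℝ :=
  M.mean + ∑ p ∈ M.S₁, M.φ₁ p (x p) + ∑ j ∈ M.S₂, M.φ₂ j (x j.1.1) (x j.1.2)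
    + ∑ l ∈ pairVars M.S₂, M.φ₁ l (x l)

/-- All components are Hölder continuous with constant `L` and exponent `α`. -/
def IsHolder (M : BivariateSPAM d) (L α : ℝ) : Prop :=
  (∀ p ∈ M.S₁ ∪ pairVars M.S₂, ∀ s ∈ Set.Icc (-1 : ℝ) 1, ∀ t ∈ Set.Icc (-1 : ℝ) 1,
    |M.φ₁ p s - M.φ₁ p t| ≤ L * |s - t| ^ α) ∧
  (∀ j ∈ M.S₂, ∀ s₁ ∈ Set.Icc (-1 : ℝ) 1, ∀ s₂ ∈ Set.Icc (-1 : ℝ) 1,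
    ∀ t₁ ∈ Set.Icc (-1 : ℝ) 1, ∀ t₂ ∈ Set.Icc (-1 : ℝ) 1,
    |M.φ₂ j s₁ s₂ - M.φ₂ j t₁ t₂| ≤ L * Real.sqrt ((s₁ - t₁) ^ 2 + (s₂ - t₂) ^ 2) ^ α)

/-- Each component indexed by `S₁` exceeds `D₁`, and each one indexed by `S₂` exceeds `D₂`,
in absolute value at some point. -/
def IsIdentifiable (M : BivariateSPAM d) (D₁ D₂ : ℝ) : Prop :=
  (∀ p ∈ M.S₁, ∃ t ∈ Set.Icc (-1 : ℝ) 1, D₁ < |M.φ₁ p t|) ∧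
  (∀ j ∈ M.S₂, ∃ t₁ ∈ Set.Icc (-1 : ℝ) 1, ∃ t₂ ∈ Set.Icc (-1 : ℝ) 1, D₂ < |M.φ₂ j t₁ t₂|)

end BivariateSPAM

/-- `(d, t)`-hash family: any `t` distinct coordinates are separated by some member. -/
def IsHashFamily {d N : ℕ} (t : ℕ) (H : Fin N → Fin d → Fin t) : Prop :=
  ∀ i : Fin t → Fin d, Function.Injective i → ∃ s, Function.Injective (H s ∘ i)

/-! ### The two `ℓ₁`-minimization programs -/

/-- `z` is feasible for (P1): `‖y - B z‖₂ ≤ ν`. -/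
def FeasibleP1 {n : ℕ} {ι : Type*} [Fintype ι] (ν : ℝ) (y : Fin n → ℝ)
    (B : Matrix (Fin n) ι ℝ) (z : ι → ℝ) : Prop :=
  Real.sqrt (∑ i, (y i - B.mulVec z i) ^ 2) ≤ ν

/-- `z` is feasible for (P2): `‖y - B z‖₁ ≤ ν`. -/
def FeasibleP2 {n : ℕ} {ι : Type*} [Fintype ι] (ν : ℝ) (y : Fin n → ℝ)
    (B : Matrix (Fin n) ι ℝ) (z : ι → ℝ) : Prop :=
  ∑ i, |y i - B.mulVec z i| ≤ ν

/-- `z` has minimal `ℓ₁`-norm among the feasible vectors. -/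
def IsL1Minimizer {ι : Type*} [Fintype ι] (Feasible : (ι → ℝ) → Prop) (z : ι → ℝ) : Prop :=
  Feasible z ∧ ∀ w, Feasible w → ∑ j, |z j| ≤ ∑ j, |w j|

/-- `sparseRec` returns a solution of (P1) whenever there is one. -/
def SolvesP1 {n : ℕ} {ι : Type*} [Fintype ι] (ν : ℝ)
    (sparseRec : (Fin n → ℝ) → Matrix (Fin n) ι ℝ → ι → ℝ) : Prop :=
  ∀ y B, (∃ z, IsL1Minimizer (FeasibleP1 ν y B) z) →
    IsL1Minimizer (FeasibleP1 ν y B) (sparseRec y B)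

/-- `sparseRec` returns a solution of (P2) whenever there is one. -/
def SolvesP2 {n : ℕ} {ι : Type*} [Fintype ι] (ν : ℝ)
    (sparseRec : (Fin n → ℝ) → Matrix (Fin n) ι ℝ → ι → ℝ) : Prop :=
  ∀ y B, (∃ z, IsL1Minimizer (FeasibleP2 ν y B) z) →
    IsL1Minimizer (FeasibleP2 ν y B) (sparseRec y B)

/-! ### The sampling scheme -/

/-- A Rademacher sign, `true` for `+1` and `false` for `-1`. -/
def sgn (b : Bool) : ℝ := if b then 1 else -1

/-- Indices of the one-dimensional grid `{-1, -(m-1)/m, …, (m-1)/m, 1}`. -/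
abbrev Grid (m : ℕ) : Type := Fin (2 * m + 1)

/-- The `k`-th grid value `(k - m) / m`. -/
noncomputable def gridValue (m : ℕ) (k : Grid m) : ℝ := ((k : ℕ) - (m : ℝ)) / m

/-- The inputs of the algorithm that estimates first `S₂` and then `S₁`: grid sizes, numbers of
measurements, thresholds, a finite family of maps from the coordinates to two classes, and
the two sparse recovery routines. The second one is used for the set `P` of remaining
coordinates. -/
structure Inputs (d : ℕ) where
  m₂ : ℕ
  n₂ : ℕ
  ε₂ : ℝ
  N : ℕ
  hash : Fin N → Fin d → Fin 2
  sparseRec₂ : (Fin n₂ → ℝ) → Matrix (Fin n₂) (Pair d) ℝ → Pair d → ℝ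
  m₁ : ℕ
  n₁ : ℕ
  ε₁ : ℝ
  sparseRec₁ : (P : Finset (Fin d)) → (Fin n₁ → ℝ) → Matrix (Fin n₁) P ℝ → P → ℝ

namespace Inputs

variable {d : ℕ} (A : Inputs d)

/-- Values of the sign vectors `β₁, …, β_{n₂} ∈ {-1, 1}^d` of the first stage. -/
abbrev Signs₂ : Type := Fin A.n₂ → Fin d → Bool

/-- Values of the sign vectors `β₁, …, β_{n₁} ∈ {-1, 1}^P` of the second stage. -/
abbrev Signs₁ (P : Finset (Fin d)) : Type := Fin A.n₁ → P → Bool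

/-- The queries of the first stage: one for each member `h` of the family, each point
`c₁ e₁(h) + c₂ e₂(h)` of the two-dimensional grid, each `i ≤ n₂` and each of the four patterns
`s`. Here `s a` tells whether the sign vector is negated on the class `a` of `h`. -/
abbrev Query₂ : Type := Fin A.N × (Fin 2 → Grid A.m₂) × Fin A.n₂ × (Fin 2 → Bool)

/-- The queries of the second stage: one for each grid point `(c, …, c)`, each `i ≤ n₁`, and
each of the two points `x⁺` (`true`) and `x⁻` (`false`). -/
abbrev Query₁ : Type := Grid A.m₁ × Fin A.n₁ × Bool

/-- The point queried in the first stage: the base point `x_q = c_{h(q)}`, with those coordinates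
set to zero at which the (possibly negated) sign is `-1`. -/
noncomputable def point₂ (β : A.Signs₂) : A.Query₂ → Fin d → ℝ := fun (t, c, i, s) q =>
  if xor (β i q) (s (A.hash t q)) then gridValue A.m₂ (c (A.hash t q)) else 0

/-- The point queried in the second stage: the coordinate `q` is `c` if `q ∈ P` has the required
sign, and `0` otherwise. -/
noncomputable def point₁ (P : Finset (Fin d)) (γ : A.Signs₁ P) : A.Query₁ → Fin d → ℝ :=
  fun (c, i, b) q =>
    if hq : q ∈ P then (if γ i ⟨q, hq⟩ = b then gridValue A.m₁ c else 0) else 0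

/-- The measurement matrix of the first stage, with entries `β_{j₁} β_{j₂}`. -/
def matrix₂ (β : A.Signs₂) : Matrix (Fin A.n₂) (Pair d) ℝ :=
  Matrix.of fun i j => sgn (β i j.1.1) * sgn (β i j.1.2)

/-- The measurement matrix of the second stage, with entries `β_p`. -/
def matrix₁ (P : Finset (Fin d)) (γ : A.Signs₁ P) : Matrix (Fin A.n₁) P ℝ :=
  Matrix.of fun i p => sgn (γ i p)

/-- The measurements of the first stage: `y_i = f̃(x₁) - f̃(x₂) - f̃(x₃) + f̃(x₄)`, where each
negated class contributes a factor `-1`. -/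
def data₂ (answer : A.Query₂ → ℝ) (t : Fin A.N) (c : Fin 2 → Grid A.m₂) : Fin A.n₂ → ℝ :=
  fun i => ∑ s : Fin 2 → Bool, (∏ a, if s a then (-1 : ℝ) else 1) * answer (t, c, i, s)

/-- The measurements of the second stage: `y_i = f̃(x⁺) - f̃(x⁻)`. -/
def data₁ (answer : A.Query₁ → ℝ) (c : Grid A.m₁) : Fin A.n₁ → ℝ :=
  fun i => answer (c, i, true) - answer (c, i, false)

open Classical in
/-- The estimate of `S₂`, computed from the signs and the answers to the queries: all pairs that
are separated by some `h` and whose recovered coefficient exceeds the threshold at some point of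
the grid of this `h`. -/
noncomputable def estimate₂ (β : A.Signs₂) (answer : A.Query₂ → ℝ) : Finset (Pair d) :=
  Finset.univ.filter fun j => ∃ (t : Fin A.N) (c : Fin 2 → Grid A.m₂),
    A.hash t j.1.1 ≠ A.hash t j.1.2 ∧
      A.ε₂ < |A.sparseRec₂ (A.data₂ answer t c) (A.matrix₂ β) j|

open Classical in
/-- The estimate of `S₁`, computed from the signs and the answers to the queries. -/
noncomputable def estimate₁ (P : Finset (Fin d)) (γ : A.Signs₁ P) (answer : A.Query₁ → ℝ) :
    Finset (Fin d) :=
  Finset.univ.filter fun q => ∃ (hq : q ∈ P) (c : Grid A.m₁),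
    A.ε₁ < |A.sparseRec₁ P (A.data₁ answer c) (A.matrix₁ P γ) ⟨q, hq⟩|

/-- An arbitrary noise, one value for each query. It may depend on all random signs drawn so far
(and on everything else that is fixed). -/
structure Noise where
  η₂ : A.Signs₂ → A.Query₂ → ℝ
  η₁ : A.Signs₂ → (P : Finset (Fin d)) → A.Signs₁ P → A.Query₁ → ℝ

/-- The noise is bounded by `ε` in every query. -/
def Noise.BoundedBy {A : Inputs d} (η : A.Noise) (ε : ℝ) : Prop :=
  (∀ β k, |η.η₂ β k| ≤ ε) ∧ (∀ β P γ k, |η.η₁ β P γ k| ≤ ε)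

/-- What a run of the algorithm produces: the two estimated sets, and the points queried
(with multiplicity). -/
structure Outcome (d : ℕ) where
  S₂ : Finset (Pair d)
  S₁ : Finset (Fin d)
  queries : Multiset (Fin d → ℝ)

/-- The law of the outcome of the algorithm for the function `f` and the noise `η`: draw the
independent Rademacher vectors of the first stage, query, and estimate `S₂`; then remove all
coordinates that occur in the estimate, draw independent Rademacher vectors indexed by the set `P`
of remaining coordinates, query, and estimate `S₁`. -/
noncomputable def law (f : (Fin d → ℝ) → ℝ) (η : A.Noise) : PMF (Outcome d) :=
  (PMF.uniformOfFintype A.Signs₂).bind fun β =>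
    let S₂ := A.estimate₂ β fun k => f (A.point₂ β k) + η.η₂ β k
    let P := (pairVars S₂)ᶜ
    (PMF.uniformOfFintype (A.Signs₁ P)).map fun γ =>
      { S₂ := S₂
        S₁ := A.estimate₁ P γ fun k => f (A.point₁ P γ k) + η.η₁ β P γ k
        queries := Finset.univ.val.map (A.point₂ β) + Finset.univ.val.map (A.point₁ P γ) }

end Inputs

/-- `|S₂| log(d² / |S₂|)`, which is `0` for empty `S₂`. -/
noncomputable def complexity₂ (d : ℕ) (S₂ : Finset (Pair d)) : ℝ :=
  S₂.card * Real.log ((d : ℝ) ^ 2 / S₂.card)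

/-- `|S₁| log(max {2, (d - |S₂⁽¹⁾|) / |S₁|})` with `S₂⁽¹⁾ = pairVars S₂`, which is `0` for
empty `S₁`. -/
noncomputable def complexity₁ (d : ℕ) (S₁ : Finset (Fin d)) (S₂ : Finset (Pair d)) : ℝ :=
  S₁.card * Real.log (max 2 (((d : ℝ) - (pairVars S₂).card) / S₁.card))

end SPAM

/-! Anchoring at zero makes each stage linear. In the alternating sum over four queries, everything
that depends on at most one hash class cancels, and each separated pair contributes its value times
a product of two signs (`sum_sign_mul_eval`). Once the coordinates of `S₂` are frozen at zero, a
difference of two queries measures the univariate values through single signs (`eval_sub_eval`).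
Both are noisy measurements of sparse vectors by matrices of characters of order at most two.

Such matrices are bounded from below in `ℓ₁` on the cone of approximately sparse vectors. By
hypercontractivity a fixed row form has first moment at least 1/18 of its Euclidean norm. A Chernoff
bound gives `card_filter_sum_abs_le`, and Maurey's method supplies a net small enough for a union
bound (`card_filter_not_isRobust_le`). Robustness on the cone makes `ℓ₁`-minimization stable
(`abs_sub_le_of_isRobust`), so every coefficient is recovered up to a third of the identifiability
level. The grid costs another third, and thresholding is exact.

Robustness is uniform over vectors. Hence one draw of signs serves all hash functions and grid
points, and the noise may depend on the signs. -/

namespace SPAM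

open Finset BigOperators

/-! ### Moments and small-ball estimates for Rademacher chaos of order at most two -/

section Chaos

variable {ι : Type*}

lemma sgn_mul_self (b : Bool) : sgn b * sgn b = 1 := by
  cases b <;> simp [sgn]

lemma sgn_not (b : Bool) : sgn (!b) = -sgn b := by
  cases b <;> simp [sgn]

/-- The character `∏_{i ∈ T} ω_i` of the hypercube. -/
noncomputable def character (T : Finset ι) (ω : ι → Bool) : ℝ := ∏ i ∈ T, sgn (ω i)

lemma character_sq (T : Finset ι) (ω : ι → Bool) : character T ω ^ 2 = 1 := by
  rw [character, ← prod_pow]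
  exact prod_eq_one fun i _ => by rw [sq, sgn_mul_self]

/-- The part of degree at most `k` of the polynomial with coefficients `a` in the variables
`s`. -/
noncomputable def chaos (a : Finset ι → ℝ) (s : Finset ι) (k : ℕ) (ω : ι → Bool) : ℝ :=
  ∑ T ∈ s.powerset, if T.card ≤ k then a T * character T ω else 0

lemma sum_mul_character_eq_chaos [Fintype ι] {J : Type*} [Fintype J] {T : J → Finset ι} (hT : Function.Injective T)
    (hcard : ∀ j, (T j).card ≤ 2) (u : J → ℝ) (ω : ι → Bool) :
    ∑ j, u j * character (T j) ω = chaos (Function.extend T u 0) univ 2 ω := by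
  rw [chaos, powerset_univ]
  refine Fintype.sum_of_injective T hT _ _ (fun S hS => ?_) (fun j => ?_)
  · rw [Function.extend_apply' _ _ _ (by simpa using hS)]; simp
  · rw [hT.extend_apply, if_pos (hcard j)]

variable [DecidableEq ι]

lemma chaos_update (a : Finset ι → ℝ) {s : Finset ι} (k : ℕ) {i : ι} (hi : i ∉ s)
    (ω : ι → Bool) (b : Bool) :
    chaos a s k (Function.update ω i b) = chaos a s k ω := by
  refine sum_congr rfl fun T hT => ?_
  have : character T (Function.update ω i b) = character T ω := by
    refine prod_congr rfl fun x hx => ?_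
    have : x ≠ i := fun h => hi (h ▸ mem_powerset.mp hT hx)
    rw [Function.update_of_ne this]
  rw [this]

lemma chaos_insert_zero (a : Finset ι → ℝ) {s : Finset ι} {i : ι} (hi : i ∉ s) (ω : ι → Bool) :
    chaos a (insert i s) 0 ω = chaos a s 0 ω := by
  rw [chaos, sum_powerset_insert hi, chaos]
  simp

lemma chaos_insert_succ (a : Finset ι → ℝ) {s : Finset ι} {i : ι} (hi : i ∉ s) (k : ℕ)
    (ω : ι → Bool) :
    chaos a (insert i s) (k + 1) ω =
      chaos a s (k + 1) ω + sgn (ω i) * chaos (fun T => a (insert i T)) s k ω := by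
  rw [chaos, sum_powerset_insert hi, chaos, chaos, mul_sum]
  congr 1
  refine sum_congr rfl fun T hT => ?_
  have hiT : i ∉ T := fun h => hi (mem_powerset.mp hT h)
  rw [card_insert_of_notMem hiT, character, prod_insert hiT, ← character]
  simp only [Nat.add_le_add_iff_right]
  split_ifs <;> ring

variable [Fintype ι]

lemma expect_sgn_mul (i : ι) (g : (ι → Bool) → ℝ)
    (hg : ∀ ω b, g (Function.update ω i b) = g ω) : 𝔼 ω, sgn (ω i) * g ω = 0 := by
  -- Flipping the sign at `i` preserves the uniform measure, fixes `g` and negates the average.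
  have hinv : Function.Involutive fun ω : ι → Bool => Function.update ω i (!ω i) := by
    intro ω
    ext j
    by_cases h : j = i
    · subst h; simp
    · simp [Function.update_of_ne h]
  have h := Fintype.expect_equiv hinv.toPerm
    (fun ω => sgn (Function.update ω i (!ω i) i) * g (Function.update ω i (!ω i)))
    (fun ω => sgn (ω i) * g ω) (fun ω => rfl)
  simp only [Function.update_self, sgn_not, hg, neg_mul, expect_neg_distrib] at h
  linarith

lemma expect_add_sgn_mul_sq (i : ι) (g h : (ι → Bool) → ℝ)
    (hg : ∀ ω b, g (Function.update ω i b) = g ω) (hh : ∀ ω b, h (Function.update ω i b) = h ω) :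
    𝔼 ω, (g ω + sgn (ω i) * h ω) ^ 2 = 𝔼 ω, g ω ^ 2 + 𝔼 ω, h ω ^ 2 := by
  have h0 := expect_sgn_mul i (fun ω => 2 * (g ω * h ω)) (fun ω b => by rw [hg, hh])
  rw [← add_zero (𝔼 ω, g ω ^ 2 + 𝔼 ω, h ω ^ 2), ← h0, ← expect_add_distrib, ← expect_add_distrib]
  refine expect_congr rfl fun ω _ => ?_
  linear_combination (h ω) ^ 2 * sgn_mul_self (ω i)

lemma expect_add_sgn_mul_pow_four (i : ι) (g h : (ι → Bool) → ℝ)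
    (hg : ∀ ω b, g (Function.update ω i b) = g ω) (hh : ∀ ω b, h (Function.update ω i b) = h ω) :
    𝔼 ω, (g ω + sgn (ω i) * h ω) ^ 4 =
      𝔼 ω, g ω ^ 4 + 6 * 𝔼 ω, g ω ^ 2 * h ω ^ 2 + 𝔼 ω, h ω ^ 4 := by
  have h0 := expect_sgn_mul i (fun ω => 4 * (g ω ^ 3 * h ω) + 4 * (g ω * h ω ^ 3))
    (fun ω b => by rw [hg, hh])
  rw [← add_zero (_ + 𝔼 ω, h ω ^ 4), ← h0, mul_expect, ← expect_add_distrib,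
    ← expect_add_distrib, ← expect_add_distrib]
  refine expect_congr rfl fun ω _ => ?_
  have h1 := sgn_mul_self (ω i)
  linear_combination (6 * g ω ^ 2 * h ω ^ 2 + 4 * g ω * h ω ^ 3 * sgn (ω i) +
    h ω ^ 4 * (sgn (ω i) ^ 2 + 1)) * h1

lemma expect_mul_sq_le (g h : (ι → Bool) → ℝ) :
    (𝔼 ω, g ω ^ 2 * h ω ^ 2) ^ 2 ≤ (𝔼 ω, g ω ^ 4) * 𝔼 ω, h ω ^ 4 := by
  have h1 := sum_mul_sq_le_sq_mul_sq univ (fun ω => g ω ^ 2) (fun ω => h ω ^ 2)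
  simp only [← pow_mul] at h1
  norm_num at h1
  simp only [Fintype.expect_eq_sum_div_card, div_pow, div_mul_div_comm, ← sq]
  gcongr

/-- Bonami's hypercontractive inequality for the fourth moment. -/
lemma expect_chaos_pow_four_le (s : Finset ι) : ∀ (k : ℕ) (a : Finset ι → ℝ),
    𝔼 ω, chaos a s k ω ^ 4 ≤ 9 ^ k * (𝔼 ω, chaos a s k ω ^ 2) ^ 2 := by
  induction s using Finset.induction_on with
  | empty =>
    intro k a
    simp only [chaos, powerset_empty, sum_singleton, card_empty, Nat.zero_le, if_true, character,
      prod_empty, mul_one, expect_const univ_nonempty, ← pow_mul]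
    have : (1 : ℝ) ≤ 9 ^ k := one_le_pow₀ (by norm_num)
    exact le_mul_of_one_le_left (by positivity) this
  | insert i s hi ih =>
    intro k a
    cases k with
    | zero => simpa only [chaos_insert_zero a hi] using ih 0 a
    | succ k =>
      simp only [chaos_insert_succ a hi]
      set a' : Finset ι → ℝ := fun T => a (insert i T)
      rw [expect_add_sgn_mul_sq i _ _ (chaos_update a _ hi) (chaos_update a' _ hi),
        expect_add_sgn_mul_pow_four i _ _ (chaos_update a _ hi) (chaos_update a' _ hi)]
      have hg := ih (k + 1) a
      have hh := ih k a'
      have hgh := expect_mul_sq_le (chaos a s (k + 1)) (chaos a' s k)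
      have hG : 0 ≤ 𝔼 ω, chaos a s (k + 1) ω ^ 2 := expect_nonneg fun _ _ => sq_nonneg _
      have hH : 0 ≤ 𝔼 ω, chaos a' s k ω ^ 2 := expect_nonneg fun _ _ => sq_nonneg _
      have hH4 : 0 ≤ 𝔼 ω, chaos a' s k ω ^ 4 :=
        expect_nonneg fun _ _ => by positivity
      set G := 𝔼 ω, chaos a s (k + 1) ω ^ 2
      set H := 𝔼 ω, chaos a' s k ω ^ 2
      set X := 𝔼 ω, chaos a s (k + 1) ω ^ 2 * chaos a' s k ω ^ 2
      have h9 : (0 : ℝ) < 9 ^ k := by positivity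
      -- Cauchy–Schwarz and both induction hypotheses. Since 6 · 3 · 9^k = 2 · 9^(k+1), the mixed
      -- term is exactly what the square of `G + H` allows.
      have hX : X ≤ 3 * 9 ^ k * (G * H) := by
        refine abs_le_of_sq_le_sq' ?_ (by positivity) |>.2
        calc X ^ 2 ≤ _ := hgh
          _ ≤ (9 ^ (k + 1) * G ^ 2) * (9 ^ k * H ^ 2) := by gcongr
          _ = _ := by ring
      have : (9 : ℝ) ^ (k + 1) = 9 * 9 ^ k := by ring
      rw [this] at hg ⊢
      nlinarith [mul_nonneg h9.le (sq_nonneg H)]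

/-- Parseval's identity, by the same splitting of one variable: the cross term has mean zero. -/
lemma expect_chaos_sq (s : Finset ι) : ∀ (k : ℕ) (a : Finset ι → ℝ),
    𝔼 ω, chaos a s k ω ^ 2 = ∑ T ∈ s.powerset, if T.card ≤ k then a T ^ 2 else 0 := by
  induction s using Finset.induction_on with
  | empty =>
    intro k a
    simp [chaos, character, expect_const univ_nonempty]
  | insert i s hi ih =>
    intro k a
    rw [sum_powerset_insert hi]
    cases k with
    | zero => simp [chaos_insert_zero a hi, ih 0 a]
    | succ k =>
      simp only [chaos_insert_succ a hi]
      rw [expect_add_sgn_mul_sq i _ _ (chaos_update a _ hi) (chaos_update _ _ hi), ih, ih]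
      congr 1
      refine sum_congr rfl fun T hT => ?_
      have hiT : i ∉ T := fun h => hi (mem_powerset.mp hT h)
      simp [card_insert_of_notMem hiT]

variable {J : Type*} [Fintype J]

lemma expect_sum_character_sq {T : J → Finset ι} (hT : Function.Injective T)
    (hcard : ∀ j, (T j).card ≤ 2) (u : J → ℝ) :
    𝔼 ω, (∑ j, u j * character (T j) ω) ^ 2 = ∑ j, u j ^ 2 := by
  simp only [sum_mul_character_eq_chaos hT hcard]
  rw [expect_chaos_sq, powerset_univ]
  refine (Fintype.sum_of_injective T hT _ _ (fun S hS => ?_) (fun j => ?_)).symm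
  · rw [Function.extend_apply' _ _ _ (by simpa using hS)]; simp
  · rw [hT.extend_apply, if_pos (hcard j)]

lemma expect_sum_character_pow_four_le {T : J → Finset ι} (hT : Function.Injective T)
    (hcard : ∀ j, (T j).card ≤ 2) (u : J → ℝ) :
    𝔼 ω, (∑ j, u j * character (T j) ω) ^ 4 ≤ 81 * (∑ j, u j ^ 2) ^ 2 := by
  rw [← expect_sum_character_sq hT hcard]
  simp only [sum_mul_character_eq_chaos hT hcard]
  exact (expect_chaos_pow_four_le _ _ _).trans_eq (by norm_num)

/-- A minorant of the absolute value by even powers turns second and fourth moments into a lower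
bound for the first moment. -/
lemma two_mul_sq_sub_pow_four_le (y : ℝ) : 2 * (y ^ 2 - y ^ 4) ≤ |y| := by
  rw [← sq_abs, ← Even.pow_abs (by decide : Even 4) y]
  have := abs_nonneg y
  set x := |y|
  nlinarith [mul_nonneg this (mul_nonneg (show 0 ≤ x + 2 by linarith) (sq_nonneg (2 * x - 1))),
    mul_nonneg this (mul_nonneg this (sq_nonneg (x - 1/2))), mul_nonneg this (sq_nonneg (x - 1/2))]

lemma one_div_le_expect_abs_sum_character {T : J → Finset ι} (hT : Function.Injective T)
    (hcard : ∀ j, (T j).card ≤ 2) {u : J → ℝ} (hu : ∑ j, u j ^ 2 = 1) :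
    1 / 18 ≤ 𝔼 ω, |∑ j, u j * character (T j) ω| := by
  have h2 := expect_sum_character_sq hT hcard u
  have h4 := expect_sum_character_pow_four_le hT hcard u
  rw [hu] at h2 h4
  have key : ∀ ω : ι → Bool, 1 / 6 * (∑ j, u j * character (T j) ω) ^ 2
      - 1 / 864 * (∑ j, u j * character (T j) ω) ^ 4 ≤ |∑ j, u j * character (T j) ω| := by
    intro ω
    -- The scale 12 suits the fourth moment bound 81: 1/6 - 81/864 = 7/96 exceeds 1/18.
    have := two_mul_sq_sub_pow_four_le ((∑ j, u j * character (T j) ω) / 12)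
    rw [abs_div, abs_of_pos (by norm_num : (0 : ℝ) < 12)] at this
    linarith
  have := expect_le_expect (s := univ) fun ω _ => key ω
  rw [expect_sub_distrib, ← mul_expect, ← mul_expect, h2] at this
  linarith

lemma exp_neg_le {x : ℝ} (hx : 0 ≤ x) : Real.exp (-x) ≤ 1 - x + x ^ 2 / 2 := by
  have h := Real.quadratic_le_exp_of_nonneg hx
  have hpos : 0 < 1 + x + x ^ 2 / 2 := by positivity
  rw [Real.exp_neg]
  refine (inv_anti₀ hpos h).trans ?_
  rw [inv_le_iff_one_le_mul₀ hpos]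
  nlinarith [sq_nonneg (x ^ 2)]

/-- The second-order bound for the exponential gives 1 - 1/324 + 1/648 = 1 - 1/648. -/
lemma expect_exp_neg_abs_le {T : J → Finset ι} (hT : Function.Injective T)
    (hcard : ∀ j, (T j).card ≤ 2) {u : J → ℝ} (hu : ∑ j, u j ^ 2 = 1) :
    𝔼 ω, Real.exp (-(1 / 18 * |∑ j, u j * character (T j) ω|)) ≤ Real.exp (-(1 / 648)) := by
  have h1 := one_div_le_expect_abs_sum_character hT hcard hu
  have h2 := expect_sum_character_sq hT hcard u
  have := expect_le_expect (s := univ) fun (ω : ι → Bool) _ =>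
    exp_neg_le (x := 1 / 18 * |∑ j, u j * character (T j) ω|) (by positivity)
  refine this.trans (le_trans (b := -(1 / 648) + 1) ?_ (Real.add_one_le_exp _))
  simp only [mul_pow, sq_abs]
  rw [expect_add_distrib, expect_sub_distrib, expect_const univ_nonempty, ← mul_expect,
    ← expect_div, ← mul_expect, h2, hu]
  linarith

/-- The rows of a random matrix, evaluated at a fixed vector, rarely have a small `ℓ₁`-norm. -/
lemma card_filter_sum_abs_le {T : J → Finset ι} (hT : Function.Injective T)
    (hcard : ∀ j, (T j).card ≤ 2) (n : ℕ) {u : J → ℝ} (hu : ∑ j, u j ^ 2 = 1) :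
    ((univ.filter fun β : Fin n → ι → Bool =>
        ∑ i, |∑ j, u j * character (T j) (β i)| ≤ n / 72).card : ℝ) ≤
      Real.exp (-(n / 1296)) * Fintype.card (Fin n → ι → Bool) := by
  set w : (ι → Bool) → ℝ := fun ω => Real.exp (-(1 / 18 * |∑ j, u j * character (T j) ω|)) with hw
  have hsum : ∑ β : Fin n → ι → Bool, ∏ i, w (β i) = (∑ ω, w ω) ^ n := by
    rw [← Fintype.piFinset_univ, ← Finset.prod_univ_sum (fun _ : Fin n => univ) (fun _ ω => w ω)]
    simp
  have hw1 : ∑ ω, w ω ≤ Real.exp (-(1 / 648)) * Fintype.card (ι → Bool) := by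
    have := expect_exp_neg_abs_le hT hcard hu
    rwa [Fintype.expect_eq_sum_div_card, div_le_iff₀ (by positivity)] at this
  -- Markov's inequality for the exponential: on the bad event the product of the weights is at
  -- least exp(-n/1296), while its mean is at most exp(-n/648).
  have hmarkov : ((univ.filter fun β : Fin n → ι → Bool =>
        ∑ i, |∑ j, u j * character (T j) (β i)| ≤ n / 72).card : ℝ) * Real.exp (-(n / 1296)) ≤
      ∑ β : Fin n → ι → Bool, ∏ i, w (β i) := by
    rw [← nsmul_eq_mul, ← sum_const]
    refine (sum_le_sum fun β hβ => ?_).trans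
      (sum_le_sum_of_subset_of_nonneg (filter_subset _ _)
        fun β _ _ => prod_nonneg fun i _ => (Real.exp_pos _).le)
    have hβ' := (mem_filter.mp hβ).2
    rw [hw, ← Real.exp_sum, Real.exp_le_exp, sum_neg_distrib, ← mul_sum]
    linarith
  have hpow : (∑ ω, w ω) ^ n ≤
      Real.exp (-(n / 648)) * Fintype.card (Fin n → ι → Bool) := by
    refine (pow_le_pow_left₀ (by positivity) hw1 n).trans_eq ?_
    rw [mul_pow, ← Real.exp_nat_mul, Fintype.card_fun (α := Fin n), Fintype.card_fin]
    push_cast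
    congr 2
    ring
  rw [← mul_le_mul_iff_left₀ (Real.exp_pos (-(n / 1296 : ℝ)))]
  refine (hmarkov.trans (hsum.trans_le hpow)).trans_eq ?_
  rw [mul_right_comm, ← Real.exp_add]
  congr 2
  ring

end Chaos

/-! ### Maurey's net and the uniform lower bound on the cone -/

section Net

/-- Maurey's empirical method: a convex combination of vectors is approximated by averages of
few of them. -/
lemma exists_multiset_norm_sq_le {τ E : Type*} [Fintype τ] [NormedAddCommGroup E]
    [InnerProductSpace ℝ E] {v : τ → E} {p : τ → ℝ} {R : ℝ} (hp : ∀ t, 0 ≤ p t)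
    (hp1 : ∑ t, p t = 1) (hv : ∀ t, ‖v t‖ ^ 2 ≤ R) (m : ℕ) :
    ∃ s : Multiset τ, s.card = m ∧
      ‖(m : ℝ) • ∑ t, p t • v t - (s.map v).sum‖ ^ 2 ≤ m * R := by
  set x := ∑ t, p t • v t with hx
  induction m with
  | zero => exact ⟨0, by simp⟩
  | succ m ih =>
    obtain ⟨s, hs, hle⟩ := ih
    set y := (m : ℝ) • x - (s.map v).sum
    -- Adding a random vector of mean `x` raises the expected squared error by its variance, hence
    -- by at most `R`.
    have hsum : ∑ t, p t * ‖y + (x - v t)‖ ^ 2 ≤ ∑ t, p t * ((m + 1 : ℕ) * R) := by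
      have h1 : ∀ t, p t * ‖y + (x - v t)‖ ^ 2 =
          p t * (‖y + x‖ ^ 2 + ‖v t‖ ^ 2) - 2 * inner ℝ (y + x) (p t • v t) := by
        intro t
        rw [← add_sub_assoc, norm_sub_sq_real, inner_smul_right]
        ring
      have h2 : ‖y + x‖ ^ 2 = ‖y‖ ^ 2 + 2 * inner ℝ y x + ‖x‖ ^ 2 := norm_add_sq_real y x
      have h3 : ∑ t, p t * ‖v t‖ ^ 2 ≤ R := by
        calc ∑ t, p t * ‖v t‖ ^ 2 ≤ ∑ t, p t * R :=
              sum_le_sum fun t _ => mul_le_mul_of_nonneg_left (hv t) (hp t)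
          _ = R := by rw [← sum_mul, hp1, one_mul]
      rw [sum_congr rfl fun t _ => h1 t, sum_sub_distrib, ← mul_sum, ← inner_sum, ← hx,
        inner_add_left, real_inner_self_eq_norm_sq]
      simp only [mul_add, sum_add_distrib]
      rw [← sum_mul, ← sum_mul, hp1, h2]
      push_cast
      nlinarith [sq_nonneg ‖x‖]
    -- Some choice is no worse than the average. Positive weight is required so that the factor `p
    -- t` can be cancelled.
    obtain ⟨t, -, ht⟩ : ∃ t ∈ univ, p t * ‖y + (x - v t)‖ ^ 2 ≤ p t * ((m + 1 : ℕ) * R) ∧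
        0 < p t := by
      by_contra! hcon
      refine absurd hsum (not_le.mpr (sum_lt_sum (fun t ht => ?_) ?_))
      · rcases (hp t).eq_or_lt with h0 | h0
        · simp [← h0]
        · by_contra! hlt
          exact absurd h0 (not_lt.mpr (hcon t ht hlt.le))
      · obtain ⟨t, ht, h0⟩ : ∃ t ∈ univ, 0 < p t := by
          by_contra! h0
          linarith [sum_nonpos h0]
        refine ⟨t, ht, ?_⟩
        by_contra! hle
        exact absurd h0 (not_lt.mpr (hcon t ht hle))
    refine ⟨t ::ₘ s, by simp [hs], ?_⟩
    have : ((m + 1 : ℕ) : ℝ) • x - ((t ::ₘ s).map v).sum = y + (x - v t) := by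
      simp only [Multiset.map_cons, Multiset.sum_cons, y]
      push_cast
      rw [add_smul, one_smul]
      abel
    rw [this]
    exact le_of_mul_le_mul_left ht.1 ht.2

variable {J : Type*} [Fintype J] [DecidableEq J]

/-- A sum of signed coordinate vectors. -/
noncomputable def signedSum (s : Multiset (J × Bool)) : J → ℝ :=
  (s.map fun t => Pi.single t.1 (sgn t.2)).sum

/-- The vector `z` together with the normalized vector `B z`. -/
noncomputable def graphMap {n : ℕ} (B : Matrix (Fin n) J ℝ) :
    (J → ℝ) →ₗ[ℝ] EuclideanSpace ℝ (J ⊕ Fin n) where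
  toFun z := WithLp.toLp 2 (Sum.elim z fun i => B.mulVec z i / Real.sqrt n)
  map_add' x y := by
    ext t
    rcases t with j | i <;> simp [Matrix.mulVec_add, add_div]
  map_smul' c x := by
    ext t
    rcases t with j | i <;> simp [Matrix.mulVec_smul, mul_div_assoc]

omit [DecidableEq J] in
lemma norm_graphMap_sq {n : ℕ} (B : Matrix (Fin n) J ℝ) (z : J → ℝ) :
    ‖graphMap B z‖ ^ 2 = ∑ j, z j ^ 2 + (∑ i, B.mulVec z i ^ 2) / n := by
  rw [EuclideanSpace.real_norm_sq_eq, Fintype.sum_sum_type, sum_div]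
  simp [graphMap, div_pow]

lemma norm_graphMap_single_sq_le {n : ℕ} {B : Matrix (Fin n) J ℝ} (hB : ∀ i j, B i j ^ 2 = 1)
    (j : J) (b : Bool) : ‖graphMap B (Pi.single j (sgn b))‖ ^ 2 ≤ 2 := by
  have h1 : sgn b ^ 2 = 1 := by rw [sq, sgn_mul_self]
  rw [norm_graphMap_sq]
  have h2 : ∑ j', (Pi.single j (sgn b) : J → ℝ) j' ^ 2 = 1 := by
    rw [sum_eq_single j (fun k _ hk => by simp [hk]) (by simp), Pi.single_eq_same, h1]
  have h3 : ∀ i, B.mulVec (Pi.single j (sgn b)) i ^ 2 = 1 := by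
    intro i
    rw [Matrix.mulVec_single]
    simp [mul_pow, hB, h1]
  simp only [h2, h3, sum_const, card_univ, Fintype.card_fin, nsmul_eq_mul, mul_one]
  linarith [div_self_le_one (n : ℝ)]

/-- Maurey's method applied to the images under `graphMap` controls the error of the vector and of
its measurements simultaneously, by the same signed sum. -/
lemma exists_signedSum_approx {n : ℕ} {B : Matrix (Fin n) J ℝ} (hB : ∀ i j, B i j ^ 2 = 1)
    {m : ℕ} (hm : 0 < m) {h : J → ℝ} (hh : ∑ j, |h j| = m) :
    ∃ s : Multiset (J × Bool), s.card = m ∧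
      ∑ j, (h j - signedSum s j) ^ 2 ≤ 2 * m ∧
      ∑ i, (B.mulVec (h - signedSum s) i) ^ 2 ≤ n * (2 * m) := by
  have hm' : (0 : ℝ) < m := by exact_mod_cast hm
  set v : J × Bool → J → ℝ := fun t => Pi.single t.1 (sgn t.2) with hv
  -- The weights are the positive and negative parts of the entries of `h`, divided by `m`.
  set p : J × Bool → ℝ := fun t => (|h t.1| + sgn t.2 * h t.1) / (2 * m) with hp
  have hp0 : ∀ t, 0 ≤ p t := by
    rintro ⟨j, b⟩
    refine div_nonneg ?_ (by positivity)
    cases b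
    · simp only [sgn]; simpa using le_abs_self (h j)
    · simp only [sgn]; simpa using neg_le_iff_add_nonneg'.mp (neg_abs_le (h j))
  have hp1 : ∑ t, p t = 1 := by
    rw [Fintype.sum_prod_type]
    have : ∀ j, ∑ b, p (j, b) = |h j| / m := by
      intro j
      simp only [hp, Fintype.sum_bool, sgn]
      norm_num
      field_simp
      ring
    rw [sum_congr rfl fun j _ => this j, ← sum_div, hh, div_self hm'.ne']
  have hmean : (m : ℝ) • ∑ t, p t • v t = h := by
    ext k
    rw [Fintype.sum_prod_type, Pi.smul_apply, Finset.sum_apply, sum_eq_single k]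
    · simp only [hp, hv, Fintype.sum_bool, sgn, Pi.add_apply, Pi.smul_apply, Pi.single_eq_same,
        smul_eq_mul]
      norm_num
      field_simp
      ring
    · intro j _ hj
      simp [hv, hj.symm]
    · simp
  obtain ⟨s, hs, hle⟩ := exists_multiset_norm_sq_le (v := fun t => graphMap B (v t)) hp0 hp1
    (fun t => norm_graphMap_single_sq_le hB t.1 t.2) m
  have hmap : (m : ℝ) • ∑ t, p t • graphMap B (v t) - (s.map fun t => graphMap B (v t)).sum =
      graphMap B (h - signedSum s) := by
    rw [map_sub, signedSum, map_multiset_sum, Multiset.map_map]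
    have : graphMap B h = (m : ℝ) • ∑ t, p t • graphMap B (v t) := by
      conv_lhs => rw [← hmean]
      simp only [map_smul, map_sum]
    rw [this]
    rfl
  rw [hmap, norm_graphMap_sq] at hle
  have h1 : 0 ≤ ∑ j, (h - signedSum s) j ^ 2 := sum_nonneg fun _ _ => sq_nonneg _
  have h2 : 0 ≤ ∑ i, B.mulVec (h - signedSum s) i ^ 2 := sum_nonneg fun _ _ => sq_nonneg _
  refine ⟨s, hs, ?_, ?_⟩
  · have : 0 ≤ (∑ i, B.mulVec (h - signedSum s) i ^ 2) / n := by positivity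
    simp only [Pi.sub_apply] at hle
    linarith
  · rcases Nat.eq_zero_or_pos n with rfl | hn
    · simp
    · have hn' : (0 : ℝ) < n := by exact_mod_cast hn
      have : (∑ i, B.mulVec (h - signedSum s) i ^ 2) / n ≤ 2 * m := by linarith
      rwa [div_le_iff₀ hn', mul_comm] at this

lemma norm_toLp_le_sqrt {J : Type*} [Fintype J] {z : J → ℝ} {r : ℝ} (h : ∑ j, z j ^ 2 ≤ r) :
    ‖WithLp.toLp 2 z‖ ≤ Real.sqrt r := by
  rw [EuclideanSpace.norm_eq]
  simpa using Real.sqrt_le_sqrt h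

lemma sum_abs_le_sqrt_mul_norm {J : Type*} [Fintype J] (z : J → ℝ) :
    ∑ j, |z j| ≤ Real.sqrt (Fintype.card J) * ‖WithLp.toLp 2 z‖ := by
  rw [EuclideanSpace.norm_eq, ← Real.sqrt_mul (Nat.cast_nonneg _)]
  refine Real.le_sqrt_of_sq_le ?_
  simpa using sq_sum_le_card_mul_sum_sq (s := univ) (f := fun j => |z j|)

/-- The vectors `h` for which an `ℓ₁`-measurement matrix has to be bounded from below in order to
recover `k`-sparse vectors. -/
def InCone (k : ℕ) (h : J → ℝ) : Prop :=
  ∑ j, |h j| ≤ 2 * Real.sqrt k * ‖WithLp.toLp 2 h‖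

/-- A lower bound on signed sums extends to the whole cone. -/
lemma norm_le_of_inCone {n : ℕ} {B : Matrix (Fin n) J ℝ} (hB : ∀ i j, B i j ^ 2 = 1) {k : ℕ}
    (hk : 0 < k)
    (hnet : ∀ s : Multiset (J × Bool), s.card = 320000 * k →
      n / 72 * ‖WithLp.toLp 2 (signedSum s)‖ ≤ ∑ i, |B.mulVec (signedSum s) i|)
    {h : J → ℝ} (hh : InCone k h) :
    n * ‖WithLp.toLp 2 h‖ ≤ 144 * ∑ i, |B.mulVec h i| := by
  have hrhs : 0 ≤ ∑ i, |B.mulVec h i| := sum_nonneg fun _ _ => abs_nonneg _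
  rcases (sum_nonneg fun j _ => abs_nonneg (h j) : 0 ≤ ∑ j, |h j|).eq_or_lt with h0 | hpos
  · have : h = 0 := by
      ext j
      simpa using (sum_eq_zero_iff_of_nonneg fun j _ => abs_nonneg (h j)).mp h0.symm j (mem_univ j)
    simp [this]
  have hk' : (0 : ℝ) < k := by exact_mod_cast hk
  -- After scaling `h` to `ℓ₁`-norm `m`, the cone condition gives a ≥ 160000 √k, whereas √(2m) = 800
  -- √k. Both approximation errors are thus at most 1/200 in relative size, and (199/200)/72 - 1/200
  -- still exceeds 1/144.
  set m : ℕ := 320000 * k with hm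
  have hmr : (m : ℝ) = 320000 * k := by rw [hm]; push_cast; ring
  have hm' : (0 : ℝ) < m := by rw [hmr]; positivity
  set c : ℝ := m / ∑ j, |h j| with hc
  have hc0 : 0 < c := by positivity
  have hw : ∑ j, |(c • h) j| = m := by
    simp only [Pi.smul_apply, smul_eq_mul, abs_mul, abs_of_pos hc0, ← mul_sum]
    exact div_mul_cancel₀ _ hpos.ne'
  obtain ⟨s, hs, hs1, hs2⟩ := exists_signedSum_approx hB (by positivity) hw
  have hu := hnet s hs
  set w := c • h with hwdef
  set u := signedSum s
  set a := ‖WithLp.toLp 2 w‖ with ha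
  have ha' : a = c * ‖WithLp.toLp 2 h‖ := by
    rw [ha, hwdef, WithLp.toLp_smul, norm_smul, Real.norm_of_nonneg hc0.le]
  have hma : (m : ℝ) ≤ 2 * Real.sqrt k * a := by
    have := mul_le_mul_of_nonneg_left hh hc0.le
    rw [ha', ← hw]
    simp only [hwdef, Pi.smul_apply, smul_eq_mul, abs_mul, abs_of_pos hc0, ← mul_sum]
    linarith
  have hsmall : Real.sqrt (2 * m) ≤ a / 200 := by
    have hsk : Real.sqrt k ^ 2 = k := Real.sq_sqrt hk'.le
    have hsk0 : 0 < Real.sqrt k := Real.sqrt_pos.mpr hk'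
    rw [show (2 : ℝ) * m = (800 * Real.sqrt k) ^ 2 by rw [mul_pow, hsk, hmr]; ring,
      Real.sqrt_sq (by positivity)]
    rw [hmr] at hma
    have : Real.sqrt k * (160000 * Real.sqrt k) ≤ Real.sqrt k * a := by linarith
    linarith [le_of_mul_le_mul_left this hsk0]
  have he1 : ‖WithLp.toLp 2 (w - u)‖ ≤ a / 200 :=
    (norm_toLp_le_sqrt (by simpa using hs1)).trans hsmall
  have he2 : ∑ i, |B.mulVec (w - u) i| ≤ n * (a / 200) := by
    refine (sum_abs_le_sqrt_mul_norm _).trans ?_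
    rw [Fintype.card_fin]
    calc Real.sqrt n * ‖WithLp.toLp 2 (B.mulVec (w - u))‖
        ≤ Real.sqrt n * Real.sqrt (n * (2 * m)) := by gcongr; exact norm_toLp_le_sqrt hs2
      _ = n * Real.sqrt (2 * m) := by
          rw [Real.sqrt_mul (Nat.cast_nonneg n), ← mul_assoc, Real.mul_self_sqrt (by positivity)]
      _ ≤ n * (a / 200) := by gcongr
  have hau : a * (199 / 200) ≤ ‖WithLp.toLp 2 u‖ := by
    have := norm_sub_norm_le (WithLp.toLp 2 w) (WithLp.toLp 2 u)
    rw [← WithLp.toLp_sub] at this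
    linarith
  have hBw : ∑ i, |B.mulVec u i| ≤ ∑ i, |B.mulVec w i| + ∑ i, |B.mulVec (w - u) i| := by
    rw [← sum_add_distrib]
    refine sum_le_sum fun i _ => ?_
    rw [Matrix.mulVec_sub, Pi.sub_apply]
    have := abs_sub_abs_le_abs_sub (B.mulVec u i) (B.mulVec w i)
    rw [abs_sub_comm] at this
    linarith
  have hBh : ∑ i, |B.mulVec w i| = c * ∑ i, |B.mulVec h i| := by
    rw [mul_sum]
    refine sum_congr rfl fun i _ => ?_
    rw [hwdef, Matrix.mulVec_smul, Pi.smul_apply, smul_eq_mul, abs_mul, abs_of_pos hc0]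
  have hn0 : (0 : ℝ) ≤ n := Nat.cast_nonneg n
  have h1 : (n : ℝ) / 72 * (a * (199 / 200)) ≤ n / 72 * ‖WithLp.toLp 2 u‖ := by gcongr
  have ha0 : 0 ≤ n * a := mul_nonneg hn0 (norm_nonneg _)
  have h2 : n * a ≤ 144 * (c * ∑ i, |B.mulVec h i|) := by
    rw [← hBh]
    linarith
  rw [ha'] at h2
  refine le_of_mul_le_mul_left ?_ hc0
  linarith

/-- With N the cardinality of `J`, there are at most (e(2N + m)/m)^m multisets. Here 2N ≤ mR because
m ≥ 2k, and R ≥ 2 gives e ≤ R² and R + 1 ≤ R², so the base is at most R⁴. -/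
lemma card_sym_le {k m : ℕ} (hk : 0 < k) (hm : 2 * k ≤ m) :
    (Fintype.card (Sym (J × Bool) m) : ℝ) ≤
      Real.exp (4 * m * Real.log (max 2 ((Fintype.card J : ℝ) / k))) := by
  set R : ℝ := max 2 ((Fintype.card J : ℝ) / k) with hR
  have hR2 : 2 ≤ R := le_max_left _ _
  have hk' : (0 : ℝ) < k := by exact_mod_cast hk
  have hkm : (2 * k : ℝ) ≤ m := by exact_mod_cast hm
  have hm' : (0 : ℝ) < m := by linarith
  have hJ : 2 * (Fintype.card J : ℝ) ≤ m * R := by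
    have := (div_le_iff₀ hk').mp (le_max_right (2 : ℝ) ((Fintype.card J : ℝ) / k))
    nlinarith
  have hbase : Real.exp 1 * (2 * Fintype.card J + m) ≤ R ^ 4 * m := by
    have he : Real.exp 1 ≤ R ^ 2 := by nlinarith [Real.exp_one_lt_d9]
    have h2 : (2 * Fintype.card J + m : ℝ) ≤ R ^ 2 * m := by
      have : m * (R + 1) ≤ m * R ^ 2 := by gcongr; nlinarith
      linarith
    calc Real.exp 1 * (2 * Fintype.card J + m) ≤ R ^ 2 * (R ^ 2 * m) := by gcongr
      _ = R ^ 4 * m := by ring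
  have hfact : (m : ℝ) ^ m ≤ Real.exp 1 ^ m * (m.factorial : ℝ) := by
    have := Real.pow_div_factorial_le_exp (m : ℝ) hm'.le m
    rw [div_le_iff₀ (by positivity)] at this
    rwa [← Real.exp_nat_mul, mul_one]
  rw [Sym.card_sym_eq_choose, Fintype.card_prod, Fintype.card_bool, mul_comm (4 * (m : ℝ)),
    show Real.log R * (4 * m) = ((4 * m : ℕ) : ℝ) * Real.log R by push_cast; ring,
    Real.exp_nat_mul, Real.exp_log (by linarith), pow_mul]
  calc (((Fintype.card J * 2 + m - 1).choose m : ℕ) : ℝ)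
      ≤ ((Fintype.card J * 2 + m - 1 : ℕ) : ℝ) ^ m / m.factorial := Nat.choose_le_pow_div _ _
    _ ≤ (2 * Fintype.card J + m) ^ m / m.factorial := by
        gcongr
        calc ((Fintype.card J * 2 + m - 1 : ℕ) : ℝ) ≤ (Fintype.card J * 2 + m : ℕ) := by
              exact_mod_cast Nat.sub_le _ _
          _ = 2 * Fintype.card J + m := by push_cast; ring
    _ ≤ (R ^ 4) ^ m := by
        rw [div_le_iff₀ (by positivity)]
        refine le_of_mul_le_mul_right (a := (m : ℝ) ^ m) ?_ (by positivity)
        calc (2 * (Fintype.card J : ℝ) + m) ^ m * (m : ℝ) ^ m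
            ≤ (2 * (Fintype.card J : ℝ) + m) ^ m * (Real.exp 1 ^ m * m.factorial) := by gcongr
          _ = (Real.exp 1 * (2 * Fintype.card J + m)) ^ m * m.factorial := by rw [mul_pow]; ring
          _ ≤ (R ^ 4 * m) ^ m * m.factorial := by gcongr
          _ = (R ^ 4) ^ m * m.factorial * (m : ℝ) ^ m := by rw [mul_pow]; ring

variable {ι : Type*} [Fintype ι] [DecidableEq ι]

/-- The measurement matrix whose columns are the characters `T j`. -/
noncomputable def characterMatrix (T : J → Finset ι) {n : ℕ} (β : Fin n → ι → Bool) :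
    Matrix (Fin n) J ℝ :=
  Matrix.of fun i j => character (T j) (β i)

omit [DecidableEq J] [Fintype ι] [DecidableEq ι] in
lemma characterMatrix_mulVec (T : J → Finset ι) {n : ℕ} (β : Fin n → ι → Bool) (u : J → ℝ)
    (i : Fin n) : (characterMatrix T β).mulVec u i = ∑ j, u j * character (T j) (β i) := by
  simp [characterMatrix, Matrix.mulVec, dotProduct, mul_comm]

omit [DecidableEq J] in
-- Homogeneity reduces this to unit vectors. The strict inequality makes the bad event empty for the
-- zero vector.
lemma card_filter_sum_abs_lt {T : J → Finset ι} (hT : Function.Injective T)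
    (hcard : ∀ j, (T j).card ≤ 2) (n : ℕ) (u : J → ℝ) :
    ((univ.filter fun β : Fin n → ι → Bool =>
        ∑ i, |(characterMatrix T β).mulVec u i| < n / 72 * ‖WithLp.toLp 2 u‖).card : ℝ) ≤
      Real.exp (-(n / 1296)) * Fintype.card (Fin n → ι → Bool) := by
  rcases (norm_nonneg (WithLp.toLp 2 u)).eq_or_lt with h0 | hpos
  · rw [← h0, filter_false_of_mem]
    · simp; positivity
    · intro β _
      rw [mul_zero, not_lt]
      exact sum_nonneg fun _ _ => abs_nonneg _
  · set a := ‖WithLp.toLp 2 u‖ with ha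
    have hu : ∑ j, (a⁻¹ • u) j ^ 2 = 1 := by
      have : ∑ j, u j ^ 2 = a ^ 2 := by rw [ha, EuclideanSpace.real_norm_sq_eq]
      simp only [Pi.smul_apply, smul_eq_mul, mul_pow, ← mul_sum, this]
      field_simp
    refine le_trans ?_ (card_filter_sum_abs_le hT hcard n hu)
    refine Nat.cast_le.mpr (card_le_card fun β hβ => ?_)
    have hβ' := (mem_filter.mp hβ).2
    refine mem_filter.mpr ⟨mem_univ _, ?_⟩
    simp_rw [← characterMatrix_mulVec, Matrix.mulVec_smul, Pi.smul_apply, smul_eq_mul, abs_mul,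
      abs_of_pos (inv_pos.mpr hpos), ← mul_sum]
    rw [inv_mul_le_iff₀ hpos, mul_comm]
    exact hβ'.le

/-- `B` is bounded from below on the cone of order `k`, with `ℓ₁`-norms of measurements. -/
def IsRobust {n : ℕ} (B : Matrix (Fin n) J ℝ) (k : ℕ) : Prop :=
  ∀ h : J → ℝ, InCone k h → n * ‖WithLp.toLp 2 h‖ ≤ 144 * ∑ i, |B.mulVec h i|

open Classical in
/-- Matrices of random characters of order at most two are robust with high probability. -/
theorem card_filter_not_isRobust_le {T : J → Finset ι} (hT : Function.Injective T)
    (hcard : ∀ j, (T j).card ≤ 2) {n k : ℕ} (hk : 0 < k)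
    (hn : 3317760000 * (k * Real.log (max 2 ((Fintype.card J : ℝ) / k))) ≤ n) :
    ((univ.filter fun β : Fin n → ι → Bool => ¬ IsRobust (characterMatrix T β) k).card : ℝ) ≤
      Real.exp (-(n / 2592)) * Fintype.card (Fin n → ι → Bool) := by
  set m := 320000 * k with hm
  set bad : Sym (J × Bool) m → Finset (Fin n → ι → Bool) := fun s =>
    univ.filter fun β => ∑ i, |(characterMatrix T β).mulVec (signedSum s.1) i| <
      n / 72 * ‖WithLp.toLp 2 (signedSum s.1)‖ with hbad
  have hsub : (univ.filter fun β : Fin n → ι → Bool => ¬ IsRobust (characterMatrix T β) k) ⊆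
      univ.biUnion bad := by
    intro β hβ
    by_contra hnot
    refine (mem_filter.mp hβ).2 fun h hh => norm_le_of_inCone (fun i j => ?_) hk (fun s hs => ?_) hh
    · exact character_sq _ _
    · by_contra! hlt
      exact hnot (mem_biUnion.mpr ⟨⟨s, hs⟩, mem_univ _, mem_filter.mpr ⟨mem_univ _, hlt⟩⟩)
  have hsym := card_sym_le (J := J) hk (m := m) (by omega)
  calc ((univ.filter fun β : Fin n → ι → Bool => ¬ IsRobust (characterMatrix T β) k).card : ℝ)
      ≤ ∑ s, ((bad s).card : ℝ) := by
        exact_mod_cast (card_le_card hsub).trans card_biUnion_le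
    _ ≤ ∑ s : Sym (J × Bool) m, Real.exp (-(n / 1296)) * Fintype.card (Fin n → ι → Bool) :=
        sum_le_sum fun s _ => card_filter_sum_abs_lt hT hcard n _
    _ = Fintype.card (Sym (J × Bool) m) *
          (Real.exp (-(n / 1296)) * Fintype.card (Fin n → ι → Bool)) := by
        rw [sum_const, card_univ, nsmul_eq_mul]
    -- The constant is 2592 · 4 · 320000, so the net has at most exp(n/2592) elements and uses up
    -- half of the exponent.
    _ ≤ Real.exp (n / 2592) * (Real.exp (-(n / 1296)) * Fintype.card (Fin n → ι → Bool)) := by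
        gcongr
        refine hsym.trans (Real.exp_le_exp.mpr ?_)
        rw [hm]
        push_cast
        linarith
    _ = Real.exp (-(n / 2592)) * Fintype.card (Fin n → ι → Bool) := by
        rw [← mul_assoc, ← Real.exp_add]
        congr 2
        ring

end Net

/-! ### Existence and stability of `ℓ₁`-minimizers -/

section Recovery

variable {J : Type*} [Fintype J]

/-- The recovery routines are constrained only when a solution exists. Feasible points of norm at
most that of `w` lie in a compact set, where the minimum is attained. -/
lemma exists_isL1Minimizer {F : (J → ℝ) → Prop} (hF : IsClosed {z | F z}) {w : J → ℝ}
    (hw : F w) : ∃ z, IsL1Minimizer F z := by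
  have hcont : Continuous fun z : J → ℝ => ∑ j, |z j| := by fun_prop
  have hcomp : IsCompact ({z | F z} ∩ Metric.closedBall 0 (∑ j, |w j|)) :=
    (isCompact_closedBall _ _).inter_left hF
  have hmem : ∀ z, F z → ∑ j, |z j| ≤ ∑ j, |w j| →
      z ∈ {z | F z} ∩ Metric.closedBall 0 (∑ j, |w j|) := by
    refine fun z hz hle => ⟨hz, ?_⟩
    rw [mem_closedBall_zero_iff, pi_norm_le_iff_of_nonneg (sum_nonneg fun _ _ => abs_nonneg _)]
    exact fun j => (single_le_sum (f := fun j => |z j|) (fun _ _ => abs_nonneg _)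
      (mem_univ j)).trans hle
  obtain ⟨z, hz, hmin⟩ := hcomp.exists_isMinOn ⟨w, hmem w hw le_rfl⟩ hcont.continuousOn
  refine ⟨z, hz.1, fun v hv => ?_⟩
  rcases le_total (∑ j, |v j|) (∑ j, |w j|) with h | h
  · exact hmin (hmem v hv h)
  · exact (hmin (hmem w hw le_rfl)).trans h

lemma continuous_mulVec_apply {n : ℕ} (B : Matrix (Fin n) J ℝ) (i : Fin n) :
    Continuous fun z : J → ℝ => B.mulVec z i := by
  simp only [Matrix.mulVec, dotProduct]
  fun_prop

lemma isClosed_feasibleP1 {n : ℕ} (ν : ℝ) (y : Fin n → ℝ) (B : Matrix (Fin n) J ℝ) :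
    IsClosed {z | FeasibleP1 ν y B z} := by
  have := continuous_mulVec_apply B
  exact isClosed_le (by fun_prop) continuous_const

lemma isClosed_feasibleP2 {n : ℕ} (ν : ℝ) (y : Fin n → ℝ) (B : Matrix (Fin n) J ℝ) :
    IsClosed {z | FeasibleP2 ν y B z} := by
  have := continuous_mulVec_apply B
  exact isClosed_le (by fun_prop) continuous_const

/-- Cauchy–Schwarz lets the same `ℓ₁`-robustness serve both programs. -/
lemma FeasibleP1.feasibleP2 {n : ℕ} {ν : ℝ} {y : Fin n → ℝ} {B : Matrix (Fin n) J ℝ} {z : J → ℝ}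
    (h : FeasibleP1 ν y B z) : FeasibleP2 (Real.sqrt n * ν) y B z := by
  refine (sum_abs_le_sqrt_mul_norm fun i => y i - B.mulVec z i).trans ?_
  rw [Fintype.card_fin]
  gcongr
  rw [EuclideanSpace.norm_eq]
  simpa [FeasibleP1] using h

/-- Minimality forces the mass of the error off `S` to be at most its mass on `S`. Cauchy–Schwarz on
`S` then gives the factor 2√k. -/
lemma inCone_sub {z w : J → ℝ} {S : Finset J} (hz : ∀ j ∉ S, z j = 0)
    (hw : ∑ j, |w j| ≤ ∑ j, |z j|) : InCone S.card (w - z) := by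
  classical
  have h1 : ∑ j, (|w j - z j| + |z j| - |w j|) ≤ ∑ j ∈ S, 2 * |w j - z j| := by
    rw [← sum_subset (subset_univ S)]
    · refine sum_le_sum fun j _ => ?_
      have := abs_sub_abs_le_abs_sub (z j) (w j)
      rw [abs_sub_comm] at this
      linarith
    · intro j _ hj
      simp [hz j hj]
  rw [sum_sub_distrib, sum_add_distrib, ← mul_sum] at h1
  have h2 : ∑ j ∈ S, |w j - z j| ≤ Real.sqrt S.card * ‖WithLp.toLp 2 (w - z)‖ := by
    rw [EuclideanSpace.norm_eq, ← Real.sqrt_mul (Nat.cast_nonneg _)]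
    refine Real.le_sqrt_of_sq_le (sq_sum_le_card_mul_sum_sq.trans ?_)
    gcongr
    simp only [sq_abs, Pi.sub_apply, Real.norm_eq_abs]
    exact sum_le_univ_sum_of_nonneg fun _ => sq_nonneg _
  simp only [InCone, Pi.sub_apply]
  linarith

/-- Stability of `ℓ₁`-minimization. -/
lemma abs_sub_le_of_isRobust {n : ℕ} {δ : ℝ} (hδ : 0 ≤ δ) {y : Fin n → ℝ}
    {B : Matrix (Fin n) J ℝ} {z w : J → ℝ} {S : Finset J} (hsupp : ∀ j ∉ S, z j = 0)
    (hl1 : ∑ j, |w j| ≤ ∑ j, |z j|) (hz : FeasibleP2 (δ * n) y B z)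
    (hw : FeasibleP2 (δ * n) y B w) (hB : S.Nonempty → 0 < n ∧ IsRobust B S.card) (j : J) :
    |w j - z j| ≤ 288 * δ := by
  -- For empty support the minimizer is zero, so `n = 0` is harmless.
  rcases S.eq_empty_or_nonempty with rfl | hS
  · have hz0 : ∀ j, z j = 0 := fun j => hsupp j (notMem_empty j)
    have hw0 : ∑ j, |w j| ≤ 0 := by simpa [hz0] using hl1
    have := (single_le_sum (f := fun j => |w j|) (fun _ _ => abs_nonneg _) (mem_univ j)).trans hw0
    rw [hz0, sub_zero]
    exact this.trans (by positivity)
  · obtain ⟨hn, hrob⟩ := hB hS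
    have hn' : (0 : ℝ) < n := by exact_mod_cast hn
    have h1 := hrob _ (inCone_sub hsupp hl1)
    have h2 : ∑ i, |B.mulVec (w - z) i| ≤ δ * n + δ * n := by
      refine le_trans ?_ (add_le_add hz hw)
      rw [← sum_add_distrib]
      refine sum_le_sum fun i _ => ?_
      rw [Matrix.mulVec_sub, Pi.sub_apply]
      have := abs_sub (y i - B.mulVec z i) (y i - B.mulVec w i)
      rwa [sub_sub_sub_cancel_left] at this
    have h3 : |w j - z j| ≤ ‖WithLp.toLp 2 (w - z)‖ := by
      simpa using PiLp.norm_apply_le (WithLp.toLp 2 (w - z)) j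
    have h4 : n * |w j - z j| ≤ n * (288 * δ) := by
      have := mul_le_mul_of_nonneg_left h3 hn'.le
      linarith
    exact le_of_mul_le_mul_left h4 hn'

end Recovery

/-! ### Grid approximation and linearity of the measurements -/

section Algorithm

variable {d : ℕ}

lemma gridValue_mem (m : ℕ) (k : Grid m) : gridValue m k ∈ Set.Icc (-1 : ℝ) 1 := by
  have hk : ((k : ℕ) : ℝ) ≤ 2 * m := by
    have := k.2
    exact_mod_cast (by omega : (k : ℕ) ≤ 2 * m)
  have h0 : (0 : ℝ) ≤ (k : ℕ) := Nat.cast_nonneg _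
  rw [gridValue, Set.mem_Icc, ← abs_le, abs_div, Nat.abs_cast]
  refine div_le_one_of_le₀ ?_ (Nat.cast_nonneg _)
  rw [abs_le]
  constructor <;> linarith

lemma exists_abs_sub_gridValue_le {m : ℕ} (hm : 0 < m) {t : ℝ} (ht : t ∈ Set.Icc (-1 : ℝ) 1) :
    ∃ k : Grid m, |t - gridValue m k| ≤ 1 / m := by
  have hm' : (0 : ℝ) < m := by exact_mod_cast hm
  have h0 : 0 ≤ t * m + m := by nlinarith [ht.1]
  have h1 := Nat.floor_le h0
  have h2 := Nat.lt_floor_add_one (t * m + m)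
  have h3 : ⌊t * m + m⌋₊ ≤ 2 * m := by
    refine Nat.floor_le_of_le ?_
    push_cast
    nlinarith [ht.2]
  refine ⟨⟨⌊t * m + m⌋₊, by omega⟩, ?_⟩
  rw [gridValue, show t - ((⌊t * m + m⌋₊ : ℝ) - m) / m = (t * m + m - ⌊t * m + m⌋₊) / m by
    field_simp; ring, abs_div, abs_of_pos hm']
  gcongr
  rw [abs_le]
  constructor <;> linarith

/-- With `r` the distance to the grid, the Hölder error costs one third of the identifiability
level. -/
lemma mul_rpow_le_div_three {L D α r x : ℝ} (hL : 0 < L) (hD : 0 < D) (hα : 0 < α) (hr : 0 < r)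
    (h : (3 * L / D) ^ (1 / α) ≤ r⁻¹) (hx0 : 0 ≤ x) (hx : x ≤ r) : L * x ^ α ≤ D / 3 := by
  have h1 : 3 * L / D ≤ (r ^ α)⁻¹ := by
    have := Real.rpow_le_rpow (by positivity) h hα.le
    rwa [← Real.rpow_mul (by positivity), one_div_mul_cancel hα.ne', Real.rpow_one,
      Real.inv_rpow hr.le] at this
  have hrα : 0 < r ^ α := Real.rpow_pos_of_pos hr α
  have h2 : x ^ α ≤ r ^ α := Real.rpow_le_rpow hx0 hx hα.le
  have h3 : 3 * L * r ^ α ≤ D := by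
    rwa [le_inv_comm₀ (by positivity) hrα, inv_div, le_div_iff₀ (by positivity), mul_comm] at h1
  nlinarith

/-- Terms cancel in pairs under a flip of the class other than `a`. -/
lemma sum_sign_mul_apply (a : Fin 2) (G : Bool → ℝ) :
    ∑ s : Fin 2 → Bool, (∏ b, if s b then (-1 : ℝ) else 1) * G (s a) = 0 := by
  rw [← (finTwoArrowEquiv Bool).symm.sum_comp]
  fin_cases a <;> simp [Fintype.sum_prod_type] <;> ring

lemma sum_sign_mul_apply_apply {a b : Fin 2} (hab : a ≠ b) (G : Bool → Bool → ℝ) :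
    ∑ s : Fin 2 → Bool, (∏ b, if s b then (-1 : ℝ) else 1) * G (s a) (s b) =
      G true true - G true false - G false true + G false false := by
  rw [← (finTwoArrowEquiv Bool).symm.sum_comp]
  fin_cases a <;> fin_cases b <;> simp [Fintype.sum_prod_type] at hab ⊢ <;> ring

namespace BivariateSPAM

open Classical in
/-- The coefficient vector measured in the first stage. -/
noncomputable def signal₂ (M : BivariateSPAM d) (A : Inputs d) (t : Fin A.N)
    (c : Fin 2 → Grid A.m₂) (j : Pair d) : ℝ :=
  if j ∈ M.S₂ ∧ A.hash t j.1.1 ≠ A.hash t j.1.2 then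
    M.φ₂ j (gridValue A.m₂ (c (A.hash t j.1.1))) (gridValue A.m₂ (c (A.hash t j.1.2)))
  else 0

open Classical in
/-- The coefficient vector measured in the second stage. -/
noncomputable def signal₁ (M : BivariateSPAM d) (A : Inputs d) (P : Finset (Fin d))
    (c : Grid A.m₁) (p : P) : ℝ :=
  if (p : Fin d) ∈ M.S₁ then M.φ₁ p (gridValue A.m₁ c) else 0

end BivariateSPAM

lemma point₂_mem_cube (A : Inputs d) (β : A.Signs₂) (k : A.Query₂) : A.point₂ β k ∈ cube d := by
  intro q
  simp only [Inputs.point₂]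
  split_ifs
  · exact gridValue_mem _ _
  · norm_num

lemma point₁_mem_cube (A : Inputs d) (P : Finset (Fin d)) (γ : A.Signs₁ P) (k : A.Query₁) :
    A.point₁ P γ k ∈ cube d := by
  intro q
  simp only [Inputs.point₁]
  split_ifs
  · exact gridValue_mem _ _
  · norm_num
  · norm_num

lemma sum_sign_mul_eval (M : BivariateSPAM d) (A : Inputs d) (β : A.Signs₂) (t : Fin A.N)
    (c : Fin 2 → Grid A.m₂) (i : Fin A.n₂) :
    ∑ s : Fin 2 → Bool, (∏ a, if s a then (-1 : ℝ) else 1) * M.eval (A.point₂ β (t, c, i, s)) =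
      (A.matrix₂ β).mulVec (M.signal₂ A t c) i := by
  classical
  have hone : ∀ (q : Fin d) (φ : ℝ → ℝ), ∑ s : Fin 2 → Bool,
      (∏ a, if s a then (-1 : ℝ) else 1) * φ (A.point₂ β (t, c, i, s) q) = 0 := fun q φ =>
    sum_sign_mul_apply (A.hash t q) fun b =>
      φ (if xor (β i q) b then gridValue A.m₂ (c (A.hash t q)) else 0)
  have hconst : ∑ s : Fin 2 → Bool, (∏ a, if s a then (-1 : ℝ) else 1) * M.mean = 0 :=
    sum_sign_mul_apply 0 fun _ => M.mean
  have htwo : ∀ j ∈ M.S₂, ∑ s : Fin 2 → Bool, (∏ a, if s a then (-1 : ℝ) else 1) *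
      M.φ₂ j (A.point₂ β (t, c, i, s) j.1.1) (A.point₂ β (t, c, i, s) j.1.2) =
      sgn (β i j.1.1) * sgn (β i j.1.2) * M.signal₂ A t c j := by
    intro j hj
    by_cases hab : A.hash t j.1.1 = A.hash t j.1.2
    · rw [BivariateSPAM.signal₂, if_neg (fun h => h.2 hab), mul_zero]
      have := sum_sign_mul_apply (A.hash t j.1.2) fun b =>
        M.φ₂ j (if xor (β i j.1.1) b then gridValue A.m₂ (c (A.hash t j.1.1)) else 0)
          (if xor (β i j.1.2) b then gridValue A.m₂ (c (A.hash t j.1.2)) else 0)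
      simpa only [Inputs.point₂, hab] using this
    · have := sum_sign_mul_apply_apply hab fun b b' =>
        M.φ₂ j (if xor (β i j.1.1) b then gridValue A.m₂ (c (A.hash t j.1.1)) else 0)
          (if xor (β i j.1.2) b' then gridValue A.m₂ (c (A.hash t j.1.2)) else 0)
      refine this.trans ?_
      have hs : M.signal₂ A t c j = M.φ₂ j (gridValue A.m₂ (c (A.hash t j.1.1)))
          (gridValue A.m₂ (c (A.hash t j.1.2))) := if_pos ⟨hj, hab⟩
      rw [hs]
      have hg := fun k => (M.anchor₂ j hj _ (gridValue_mem A.m₂ k)).1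
      have hg' := fun k => (M.anchor₂ j hj _ (gridValue_mem A.m₂ k)).2
      have h0 := (M.anchor₂ j hj 0 (by norm_num)).1
      -- Exactly one of the four patterns switches on both coordinates, and its coefficient is the
      -- product of the two signs. Anchoring kills the other three.
      cases β i j.1.1 <;> cases β i j.1.2 <;> simp [sgn, hg, hg', h0]
  simp only [BivariateSPAM.eval, mul_add, sum_add_distrib, mul_sum]
  rw [hconst, sum_comm, sum_comm (s := univ) (t := M.S₂), sum_comm (s := univ) (t := pairVars M.S₂),
    sum_eq_zero fun p _ => hone p (M.φ₁ p), sum_eq_zero fun p _ => hone p (M.φ₁ p),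
    sum_congr rfl htwo, zero_add, zero_add, add_zero]
  simp only [Matrix.mulVec, dotProduct, Inputs.matrix₂, Matrix.of_apply]
  refine sum_subset (subset_univ _) fun j _ hj => ?_
  rw [BivariateSPAM.signal₂, if_neg (fun h => hj h.1), mul_zero]

lemma eval_sub_eval (M : BivariateSPAM d) (A : Inputs d)
    (γ : A.Signs₁ (pairVars M.S₂)ᶜ) (c : Grid A.m₁) (i : Fin A.n₁) :
    M.eval (A.point₁ _ γ (c, i, true)) - M.eval (A.point₁ _ γ (c, i, false)) =
      (A.matrix₁ _ γ).mulVec (M.signal₁ A _ c) i := by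
  classical
  have hout : ∀ (b : Bool), ∀ q ∈ pairVars M.S₂, A.point₁ _ γ (c, i, b) q = 0 := by
    intro b q hq
    simp [Inputs.point₁, hq]
  have hj : ∀ j ∈ M.S₂, j.1.1 ∈ pairVars M.S₂ ∧ j.1.2 ∈ pairVars M.S₂ := fun j hj =>
    ⟨mem_union_left _ (mem_image_of_mem _ hj), mem_union_right _ (mem_image_of_mem _ hj)⟩
  have heval : ∀ b, M.eval (A.point₁ _ γ (c, i, b)) =
      M.mean + ∑ p ∈ M.S₁, M.φ₁ p (A.point₁ _ γ (c, i, b) p) := by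
    intro b
    rw [BivariateSPAM.eval, sum_eq_zero (s := M.S₂) fun j hj' => ?_,
      sum_eq_zero (s := pairVars M.S₂) fun l hl => ?_, add_zero, add_zero]
    · rw [hout b l hl, M.anchor₁ l (mem_union_right _ hl)]
    · rw [hout b _ (hj j hj').1, hout b _ (hj j hj').2]
      exact (M.anchor₂ j hj' 0 (by norm_num)).1
  rw [heval, heval, add_sub_add_left_eq_sub, ← sum_sub_distrib]
  simp only [Matrix.mulVec, dotProduct, Inputs.matrix₁, Matrix.of_apply, BivariateSPAM.signal₁,
    mul_ite, mul_zero]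
  have hS : ∀ p ∈ M.S₁, p ∈ (pairVars M.S₂)ᶜ := fun p hp =>
    mem_compl.mpr (disjoint_left.mp M.disjoint hp)
  rw [← sum_filter]
  refine sum_bij' (fun p hp => ⟨p, hS p hp⟩) (fun p _ => p.1)
    (fun p hp => by simpa using hp) (fun p hp => (mem_filter.mp hp).2) (fun _ _ => rfl)
    (fun _ _ => rfl) fun p hp => ?_
  have h0 := M.anchor₁ p (mem_union_left _ hp)
  simp only [Inputs.point₁, hS p hp, dif_pos]
  cases γ i ⟨p, hS p hp⟩ <;> simp [sgn, h0]

end Algorithm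

/-! ### Complexities, and exact recovery for robust matrices -/

section Estimates

variable {d : ℕ}

lemma matrix₂_eq_characterMatrix (A : Inputs d) (β : A.Signs₂) :
    A.matrix₂ β = characterMatrix (fun j : Pair d => {j.1.1, j.1.2}) β := by
  ext i j
  simp [Inputs.matrix₂, characterMatrix, character, prod_pair j.2.ne]

lemma matrix₁_eq_characterMatrix (A : Inputs d) (P : Finset (Fin d)) (γ : A.Signs₁ P) :
    A.matrix₁ P γ = characterMatrix (fun p : P => {p}) γ := by
  ext i j
  simp [Inputs.matrix₁, characterMatrix, character]

lemma injective_pair : Function.Injective fun j : Pair d => ({j.1.1, j.1.2} : Finset (Fin d)) := by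
  rintro ⟨⟨a, b⟩, hab⟩ ⟨⟨a', b'⟩, hab'⟩ h
  have h' := Finset.ext_iff.mp h
  have h1 := (h' a).mp (by simp)
  have h2 := (h' b).mp (by simp)
  simp only [mem_insert, mem_singleton] at h1 h2
  change a < b at hab
  change a' < b' at hab'
  rw [Subtype.mk.injEq, Prod.mk.injEq]
  omega

/-- A pair and its swap are distinct points of the square. Consequently d²/|S₂| ≥ 2, so
`complexity₂` needs no maximum with 2. -/
lemma two_mul_card_pair_le (d : ℕ) : Fintype.card (Pair d) * 2 ≤ d ^ 2 := by
  have hinj : Function.Injective fun x : Pair d × Bool => if x.2 then x.1.1 else x.1.1.swap := by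
    rintro ⟨⟨⟨a, b⟩, hab⟩, x⟩ ⟨⟨⟨a', b'⟩, hab'⟩, y⟩ h
    change a < b at hab
    change a' < b' at hab'
    cases x <;> cases y <;>
      simp only [if_true, if_false, Bool.false_eq_true, Prod.swap, Prod.mk.injEq] at h <;>
      simp only [Prod.mk.injEq, Subtype.mk.injEq] <;> first | (exfalso; omega) | (simp; omega)
  simpa [sq] using Fintype.card_le_of_injective _ hinj

lemma two_mul_card_le_sq (S : Finset (Pair d)) : 2 * (S.card : ℝ) ≤ (d : ℝ) ^ 2 := by
  have h1 := two_mul_card_pair_le d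
  have h2 := card_le_univ S
  exact_mod_cast (by omega : 2 * S.card ≤ d ^ 2)

lemma log_two_le_complexity₂ {S : Finset (Pair d)} (hS : S.Nonempty) :
    Real.log 2 ≤ complexity₂ d S := by
  have hk : (1 : ℝ) ≤ S.card := by exact_mod_cast hS.card_pos
  have h := two_mul_card_le_sq S
  have h2 : Real.log 2 ≤ Real.log ((d : ℝ) ^ 2 / S.card) :=
    Real.log_le_log (by norm_num) ((le_div_iff₀ (by linarith)).mpr h)
  have h0 : 0 < Real.log 2 := Real.log_pos (by norm_num)
  rw [complexity₂]
  nlinarith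

lemma card_mul_log_max_le_complexity₂ {S : Finset (Pair d)} (hS : S.Nonempty) :
    S.card * Real.log (max 2 ((Fintype.card (Pair d) : ℝ) / S.card)) ≤ complexity₂ d S := by
  have hk : (0 : ℝ) < S.card := by exact_mod_cast hS.card_pos
  rw [complexity₂]
  refine mul_le_mul_of_nonneg_left (Real.log_le_log (lt_max_of_lt_left (by norm_num)) ?_) hk.le
  refine max_le ((le_div_iff₀ hk).mpr (two_mul_card_le_sq S)) ?_
  gcongr
  have := two_mul_card_pair_le d
  exact_mod_cast (by omega : Fintype.card (Pair d) ≤ d ^ 2)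

lemma log_two_le_complexity₁ {S₁ : Finset (Fin d)} (hS : S₁.Nonempty) (S₂ : Finset (Pair d)) :
    Real.log 2 ≤ complexity₁ d S₁ S₂ := by
  have hk : (1 : ℝ) ≤ S₁.card := by exact_mod_cast hS.card_pos
  have h2 : Real.log 2 ≤ Real.log (max 2 (((d : ℝ) - (pairVars S₂).card) / S₁.card)) :=
    Real.log_le_log (by norm_num) (le_max_left _ _)
  have h0 : 0 < Real.log 2 := Real.log_pos (by norm_num)
  rw [complexity₁]
  nlinarith

lemma complexity₂_nonneg (S : Finset (Pair d)) : 0 ≤ complexity₂ d S := by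
  rcases S.eq_empty_or_nonempty with rfl | hS
  · simp [complexity₂]
  · exact (Real.log_nonneg (by norm_num)).trans (log_two_le_complexity₂ hS)

lemma complexity₁_nonneg (S₁ : Finset (Fin d)) (S₂ : Finset (Pair d)) :
    0 ≤ complexity₁ d S₁ S₂ := by
  rcases S₁.eq_empty_or_nonempty with rfl | hS
  · simp [complexity₁]
  · exact (Real.log_nonneg (by norm_num)).trans (log_two_le_complexity₁ hS S₂)

variable {M : BivariateSPAM d} {f : (Fin d → ℝ) → ℝ} {A : Inputs d} {ε L α D₁ D₂ : ℝ}

lemma abs_sparseRec₂_sub_signal₂_le (hf : ∀ x ∈ cube d, f x = M.eval x)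
    {e : A.Query₂ → ℝ} (he : ∀ k, |e k| ≤ ε) (hε : 0 ≤ ε)
    (hsolve : SolvesP2 (4 * ε * A.n₂) A.sparseRec₂) {β : A.Signs₂}
    (hβ : M.S₂.Nonempty → 0 < A.n₂ ∧ IsRobust (A.matrix₂ β) M.S₂.card) (t : Fin A.N)
    (c : Fin 2 → Grid A.m₂) (j : Pair d) :
    |A.sparseRec₂ (A.data₂ (fun k => f (A.point₂ β k) + e k) t c) (A.matrix₂ β) j
      - M.signal₂ A t c j| ≤ 288 * (4 * ε) := by
  set y := A.data₂ (fun k => f (A.point₂ β k) + e k) t c with hy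
  have hfeas : FeasibleP2 (4 * ε * A.n₂) y (A.matrix₂ β) (M.signal₂ A t c) := by
    have hterm : ∀ i, |y i - (A.matrix₂ β).mulVec (M.signal₂ A t c) i| ≤ 4 * ε := by
      intro i
      have h1 : y i - (A.matrix₂ β).mulVec (M.signal₂ A t c) i =
          ∑ s : Fin 2 → Bool, (∏ a, if s a then (-1 : ℝ) else 1) * e (t, c, i, s) := by
        rw [← sum_sign_mul_eval, hy]
        simp only [Inputs.data₂]
        rw [← sum_sub_distrib]
        refine sum_congr rfl fun s _ => ?_
        rw [hf _ (point₂_mem_cube A β _)]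
        ring
      rw [h1]
      refine (abs_sum_le_sum_abs _ _).trans ?_
      calc ∑ s : Fin 2 → Bool, |(∏ a, if s a then (-1 : ℝ) else 1) * e (t, c, i, s)|
          ≤ ∑ s : Fin 2 → Bool, ε := by
            refine sum_le_sum fun s _ => ?_
            have hs : |∏ a, if s a then (-1 : ℝ) else 1| = 1 := by
              rw [abs_prod]
              exact prod_eq_one fun a _ => by split_ifs <;> simp
            rw [abs_mul, hs, one_mul]
            exact he _
        _ = 4 * ε := by simp
    refine (sum_le_sum fun i _ => hterm i).trans_eq ?_
    rw [sum_const, card_univ, Fintype.card_fin, nsmul_eq_mul]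
    ring
  have hmin := hsolve y (A.matrix₂ β) (exists_isL1Minimizer (isClosed_feasibleP2 _ _ _) hfeas)
  refine abs_sub_le_of_isRobust (by positivity) (fun j hj => ?_) (hmin.2 _ hfeas) hfeas hmin.1 hβ j
  exact if_neg fun h => hj h.1

/-- The recovery error is at most 1152ε = `A.ε₂` < D₂/3. Absent pairs stay at or below the
threshold. A present pair has a grid value above 2D₂/3, hence a recovered one above D₂/3. -/
lemma estimate₂_eq (hf : ∀ x ∈ cube d, f x = M.eval x) (hL : 0 < L) (hα : 0 < α) (hD₂ : 0 < D₂)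
    (hH : M.IsHolder L α) (hI : M.IsIdentifiable D₁ D₂) (hhash : IsHashFamily 2 A.hash)
    {e : A.Query₂ → ℝ} (he : ∀ k, |e k| ≤ ε) (hε : 0 ≤ ε)
    (hsolve : SolvesP2 (4 * ε * A.n₂) A.sparseRec₂) (hε₂ : A.ε₂ = 4 * 288 * ε)
    (hεD : ε < D₂ / (12 * 288)) (hm : Real.sqrt 2 * (3 * L / D₂) ^ (1 / α) ≤ A.m₂)
    {β : A.Signs₂}
    (hβ : M.S₂.Nonempty → 0 < A.n₂ ∧ IsRobust (A.matrix₂ β) M.S₂.card) :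
    A.estimate₂ β (fun k => f (A.point₂ β k) + e k) = M.S₂ := by
  classical
  have herr := abs_sparseRec₂_sub_signal₂_le hf he hε hsolve hβ
  have hs2 : 0 < Real.sqrt 2 := by positivity
  have hm0 : (0 : ℝ) < A.m₂ := lt_of_lt_of_le (by positivity) hm
  ext j
  simp only [Inputs.estimate₂, mem_filter, mem_univ, true_and]
  constructor
  · rintro ⟨t, c, hne, hlt⟩
    by_contra hj
    have := herr t c j
    rw [BivariateSPAM.signal₂, if_neg (fun h => hj h.1), sub_zero] at this
    linarith
  · intro hj
    obtain ⟨t, ht⟩ := hhash ![j.1.1, j.1.2] (by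
      intro a b hab
      have := j.2.ne
      fin_cases a <;> fin_cases b <;> simp_all [eq_comm])
    have hne : A.hash t j.1.1 ≠ A.hash t j.1.2 := fun h => by
      simpa using ht.ne (show (0 : Fin 2) ≠ 1 by decide) h
    obtain ⟨t₁, ht₁, t₂, ht₂, hD⟩ := hI.2 j hj
    have hmpos : 0 < A.m₂ := by exact_mod_cast hm0
    obtain ⟨k₁, hk₁⟩ := exists_abs_sub_gridValue_le hmpos ht₁
    obtain ⟨k₂, hk₂⟩ := exists_abs_sub_gridValue_le hmpos ht₂
    -- As the classes differ, the two grid coordinates can be chosen independently.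
    refine ⟨t, fun a => if a = A.hash t j.1.1 then k₁ else k₂, hne, ?_⟩
    have h1 := herr t (fun a => if a = A.hash t j.1.1 then k₁ else k₂) j
    have hsig : M.signal₂ A t (fun a => if a = A.hash t j.1.1 then k₁ else k₂) j =
        M.φ₂ j (gridValue A.m₂ k₁) (gridValue A.m₂ k₂) := by
      rw [BivariateSPAM.signal₂, if_pos ⟨hj, hne⟩, if_pos rfl, if_neg hne.symm]
    rw [hsig] at h1
    have h2 := hH.2 j hj t₁ ht₁ t₂ ht₂ _ (gridValue_mem A.m₂ k₁) _ (gridValue_mem A.m₂ k₂)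
    have hdist : Real.sqrt ((t₁ - gridValue A.m₂ k₁) ^ 2 + (t₂ - gridValue A.m₂ k₂) ^ 2) ≤
        Real.sqrt 2 / A.m₂ := by
      rw [← Real.sqrt_sq hm0.le, ← Real.sqrt_div (by norm_num)]
      refine Real.sqrt_le_sqrt ?_
      have e1 := pow_le_pow_left₀ (abs_nonneg _) hk₁ 2
      have e2 := pow_le_pow_left₀ (abs_nonneg _) hk₂ 2
      rw [sq_abs, div_pow, one_pow] at e1 e2
      calc _ ≤ 1 / (A.m₂ : ℝ) ^ 2 + 1 / (A.m₂ : ℝ) ^ 2 := add_le_add e1 e2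
        _ = _ := by ring
    have h3 := mul_rpow_le_div_three hL hD₂ hα (r := Real.sqrt 2 / A.m₂) (by positivity)
      (by rw [inv_div, le_div_iff₀ hs2, mul_comm]; exact hm) (Real.sqrt_nonneg _) hdist
    have h4 := h2.trans h3
    have h5 := abs_sub_abs_le_abs_sub (M.φ₂ j t₁ t₂)
      (M.φ₂ j (gridValue A.m₂ k₁) (gridValue A.m₂ k₂))
    rw [lt_div_iff₀ (by norm_num)] at hεD
    rw [abs_sub_comm] at h1
    have h6 := (abs_sub_abs_le_abs_sub _ _).trans h1
    linarith

lemma abs_sparseRec₁_sub_signal₁_le (hf : ∀ x ∈ cube d, f x = M.eval x)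
    {e : A.Query₁ → ℝ} (he : ∀ k, |e k| ≤ ε) (hε : 0 ≤ ε)
    (hsolve : SolvesP1 (2 * ε * Real.sqrt A.n₁) (A.sparseRec₁ (pairVars M.S₂)ᶜ))
    {γ : A.Signs₁ (pairVars M.S₂)ᶜ}
    (hγ : M.S₁.Nonempty → 0 < A.n₁ ∧ IsRobust (A.matrix₁ _ γ) M.S₁.card)
    (c : Grid A.m₁) (p : ((pairVars M.S₂)ᶜ : Finset (Fin d))) :
    |A.sparseRec₁ _ (A.data₁ (fun k => f (A.point₁ _ γ k) + e k) c) (A.matrix₁ _ γ) p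
      - M.signal₁ A _ c p| ≤ 288 * (2 * ε) := by
  classical
  set y := A.data₁ (fun k => f (A.point₁ _ γ k) + e k) c with hy
  have hfeas : FeasibleP1 (2 * ε * Real.sqrt A.n₁) y (A.matrix₁ _ γ) (M.signal₁ A _ c) := by
    have hterm : ∀ i, (y i - (A.matrix₁ _ γ).mulVec (M.signal₁ A _ c) i) ^ 2 ≤ (2 * ε) ^ 2 := by
      intro i
      rw [sq_le_sq, abs_of_nonneg (by positivity : 0 ≤ 2 * ε)]
      have h1 : y i - (A.matrix₁ _ γ).mulVec (M.signal₁ A _ c) i =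
          e (c, i, true) - e (c, i, false) := by
        rw [← eval_sub_eval, hy]
        simp only [Inputs.data₁]
        rw [hf _ (point₁_mem_cube A _ γ _), hf _ (point₁_mem_cube A _ γ _)]
        ring
      rw [h1]
      linarith [abs_sub (e (c, i, true)) (e (c, i, false)), he (c, i, true), he (c, i, false)]
    rw [FeasibleP1, Real.sqrt_le_left (by positivity), mul_pow, Real.sq_sqrt (Nat.cast_nonneg _)]
    refine (sum_le_sum fun i _ => hterm i).trans_eq ?_
    rw [sum_const, card_univ, Fintype.card_fin, nsmul_eq_mul]
    ring
  have hmin := hsolve y (A.matrix₁ _ γ) (exists_isL1Minimizer (isClosed_feasibleP1 _ _ _) hfeas)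
  have hν : Real.sqrt A.n₁ * (2 * ε * Real.sqrt A.n₁) = 2 * ε * A.n₁ := by
    rw [mul_comm, mul_assoc, Real.mul_self_sqrt (Nat.cast_nonneg _)]
  have hsub : ∀ q ∈ M.S₁, q ∈ (pairVars M.S₂)ᶜ := fun q hq =>
    mem_compl.mpr (disjoint_left.mp M.disjoint hq)
  -- The support of the signal is `S₁` viewed inside the subtype of remaining coordinates.
  have hcard : (M.S₁.subtype (· ∈ (pairVars M.S₂)ᶜ)).card = M.S₁.card := by
    rw [card_subtype, filter_true_of_mem hsub]
  refine abs_sub_le_of_isRobust (S := M.S₁.subtype (· ∈ (pairVars M.S₂)ᶜ)) (by positivity)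
    (fun q hq => ?_) (hmin.2 _ hfeas) (hν ▸ hfeas.feasibleP2) (hν ▸ hmin.1.feasibleP2)
    (fun h => ?_) p
  · exact if_neg fun h => hq (mem_subtype.mpr h)
  · rw [hcard]
    exact hγ (card_pos.mp (hcard ▸ h.card_pos))

lemma estimate₁_eq (hf : ∀ x ∈ cube d, f x = M.eval x) (hL : 0 < L) (hα : 0 < α) (hD₁ : 0 < D₁)
    (hH : M.IsHolder L α) (hI : M.IsIdentifiable D₁ D₂)
    {e : A.Query₁ → ℝ} (he : ∀ k, |e k| ≤ ε) (hε : 0 ≤ ε)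
    (hsolve : SolvesP1 (2 * ε * Real.sqrt A.n₁) (A.sparseRec₁ (pairVars M.S₂)ᶜ))
    (hε₁ : A.ε₁ = 2 * 288 * ε)
    (hεD : ε < D₁ / (6 * 288)) (hm : (3 * L / D₁) ^ (1 / α) ≤ A.m₁)
    {γ : A.Signs₁ (pairVars M.S₂)ᶜ}
    (hγ : M.S₁.Nonempty → 0 < A.n₁ ∧ IsRobust (A.matrix₁ _ γ) M.S₁.card) :
    A.estimate₁ _ γ (fun k => f (A.point₁ _ γ k) + e k) = M.S₁ := by
  classical
  have herr := abs_sparseRec₁_sub_signal₁_le hf he hε hsolve hγ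
  have hm0 : (0 : ℝ) < A.m₁ := lt_of_lt_of_le (by positivity) hm
  ext p
  simp only [Inputs.estimate₁, mem_filter, mem_univ, true_and]
  constructor
  · rintro ⟨hp, c, hlt⟩
    by_contra hpS
    have := herr c ⟨p, hp⟩
    rw [BivariateSPAM.signal₁, if_neg hpS, sub_zero] at this
    linarith
  · intro hpS
    obtain ⟨t, ht, hD⟩ := hI.1 p hpS
    obtain ⟨c, hc⟩ := exists_abs_sub_gridValue_le (by exact_mod_cast hm0) ht
    refine ⟨mem_compl.mpr (disjoint_left.mp M.disjoint hpS), c, ?_⟩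
    have h1 := herr c ⟨p, mem_compl.mpr (disjoint_left.mp M.disjoint hpS)⟩
    rw [BivariateSPAM.signal₁, if_pos hpS] at h1
    have h2 := hH.1 p (mem_union_left _ hpS) t ht _ (gridValue_mem A.m₁ c)
    have h3 := mul_rpow_le_div_three hL hD₁ hα (r := 1 / A.m₁) (by positivity)
      (by rwa [inv_div, div_one]) (abs_nonneg _) hc
    have h4 := h2.trans h3
    have h5 := abs_sub_abs_le_abs_sub (M.φ₁ p t) (M.φ₁ p (gridValue A.m₁ c))
    rw [lt_div_iff₀ (by norm_num)] at hεD
    rw [abs_sub_comm] at h1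
    have h6 := (abs_sub_abs_le_abs_sub _ _).trans h1
    linarith

end Estimates

/-! ### Probability of success and query count -/

section Probability

open Classical in
lemma ofReal_one_sub_le_toOuterMeasure {Ω : Type*} [Fintype Ω] [Nonempty Ω] {Q : Ω → Prop} {e : ℝ}
    (h : ((univ.filter fun ω => ¬ Q ω).card : ℝ) ≤ e * Fintype.card Ω) :
    ENNReal.ofReal (1 - e) ≤ (PMF.uniformOfFintype Ω).toOuterMeasure {ω | Q ω} := by
  have hpos : (0 : ℝ) < Fintype.card Ω := by exact_mod_cast Fintype.card_pos
  have hsum : ((univ.filter fun ω => Q ω).card : ℝ) + (univ.filter fun ω => ¬ Q ω).card =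
      Fintype.card Ω := by
    exact_mod_cast card_filter_add_card_filter_not Q
  rw [PMF.toOuterMeasure_uniformOfFintype_apply, ← ENNReal.ofReal_natCast (Fintype.card Ω),
    ← ENNReal.ofReal_natCast, ← ENNReal.ofReal_div_of_pos hpos]
  refine ENNReal.ofReal_le_ofReal ?_
  rw [le_div_iff₀ hpos, Fintype.card_of_subtype (univ.filter fun ω => Q ω) fun ω => by simp]
  linarith

/-- Conditioning on a good first stage: the second-stage bound is needed only for outcomes in `G`.
-/
lemma toOuterMeasure_mul_le_toOuterMeasure_bind {Ω Ω' : Type*} (p : PMF Ω) (g : Ω → PMF Ω')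
    {G : Set Ω} {s : Set Ω'} {c : ENNReal} (h : ∀ ω ∈ G, c ≤ (g ω).toOuterMeasure s) :
    p.toOuterMeasure G * c ≤ (p.bind g).toOuterMeasure s := by
  classical
  rw [PMF.toOuterMeasure_bind_apply, PMF.toOuterMeasure_apply, ← ENNReal.tsum_mul_right]
  refine ENNReal.tsum_le_tsum fun ω => ?_
  by_cases hω : ω ∈ G
  · rw [Set.indicator_of_mem hω]
    gcongr
    exact h ω hω
  · rw [Set.indicator_of_notMem hω, zero_mul]
    exact zero_le

variable {d : ℕ}

lemma ofReal_le_toOuterMeasure_isRobust₂ (A : Inputs d) (S : Finset (Pair d))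
    (hn : 3317760000 * complexity₂ d S ≤ A.n₂) :
    ENNReal.ofReal (1 - Real.exp (-(A.n₂ / 2592))) ≤ (PMF.uniformOfFintype A.Signs₂).toOuterMeasure
      {β | S.Nonempty → 0 < A.n₂ ∧ IsRobust (A.matrix₂ β) S.card} := by
  classical
  refine ofReal_one_sub_le_toOuterMeasure ?_
  rcases S.eq_empty_or_nonempty with rfl | hS
  · simp
    positivity
  · have hpos : 0 < A.n₂ := by
      have := log_two_le_complexity₂ hS
      have := Real.log_pos one_lt_two
      have : (0 : ℝ) < A.n₂ := by linarith
      exact_mod_cast this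
    have := card_filter_not_isRobust_le (n := A.n₂) injective_pair (fun j => card_le_two)
      hS.card_pos ((mul_le_mul_of_nonneg_left (card_mul_log_max_le_complexity₂ hS)
        (by norm_num)).trans hn)
    simpa only [hS, hpos, true_and, forall_const, matrix₂_eq_characterMatrix] using this

lemma ofReal_le_toOuterMeasure_isRobust₁ (A : Inputs d) (S₁ : Finset (Fin d))
    (S₂ : Finset (Pair d)) (hn : 3317760000 * complexity₁ d S₁ S₂ ≤ A.n₁) :
    ENNReal.ofReal (1 - Real.exp (-(A.n₁ / 2592))) ≤
      (PMF.uniformOfFintype (A.Signs₁ (pairVars S₂)ᶜ)).toOuterMeasure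
        {γ | S₁.Nonempty → 0 < A.n₁ ∧ IsRobust (A.matrix₁ _ γ) S₁.card} := by
  classical
  refine ofReal_one_sub_le_toOuterMeasure ?_
  rcases S₁.eq_empty_or_nonempty with rfl | hS
  · simp
    positivity
  · have hpos : 0 < A.n₁ := by
      have := log_two_le_complexity₁ hS S₂
      have := Real.log_pos one_lt_two
      have : (0 : ℝ) < A.n₁ := by linarith
      exact_mod_cast this
    have hcard : (Fintype.card ((pairVars S₂)ᶜ : Finset (Fin d)) : ℝ) =
        d - (pairVars S₂).card := by
      rw [Fintype.card_coe, card_compl, Fintype.card_fin, Nat.cast_sub]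
      simpa using card_le_univ (pairVars S₂)
    have := card_filter_not_isRobust_le (n := A.n₁) (k := S₁.card)
      (T := fun p : ((pairVars S₂)ᶜ : Finset (Fin d)) => {p}) singleton_injective
      (fun j => by simp) hS.card_pos (by rw [hcard]; exact hn)
    simpa only [hS, hpos, true_and, forall_const, matrix₁_eq_characterMatrix] using this

lemma card_queries (A : Inputs d) (f : (Fin d → ℝ) → ℝ) (η : A.Noise) {o : Inputs.Outcome d}
    (ho : o ∈ (A.law f η).support) : Multiset.card o.queries =
      4 * (2 * A.m₂ + 1) ^ 2 * A.n₂ * A.N + 2 * (2 * A.m₁ + 1) * A.n₁ := by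
  rw [Inputs.law, PMF.mem_support_bind_iff] at ho
  obtain ⟨β, -, ho⟩ := ho
  rw [PMF.mem_support_map_iff] at ho
  obtain ⟨γ, -, rfl⟩ := ho
  simp only [Multiset.card_add, Multiset.card_map, card_val, card_univ, Fintype.card_prod,
    Fintype.card_fin, Fintype.card_fun, Fintype.card_bool]
  ring

lemma mul_le_two_mul_add_one_pow_mul {a X : ℝ} {m n : ℕ} (k : ℕ) (ha : 0 ≤ a) (hm : a ≤ m)
    (hX : 0 ≤ X) (hn : 3317760000 * X ≤ n) : (2 * a + 1) ^ k * X ≤ (2 * m + 1) ^ k * n := by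
  gcongr
  linarith

/-- A nonzero complexity is at least log 2 > 1/2, so rounding up `n` adds at most 2X. Rounding up
`m` costs at most a factor 3 in 2a + 1. -/
lemma two_mul_add_one_pow_mul_le {a X : ℝ} {m n : ℕ} (k : ℕ) (ha : 0 ≤ a) (hm : m = ⌈a⌉₊)
    (hX : X = 0 ∨ Real.log 2 ≤ X) (hn : n = ⌈3317760000 * X⌉₊) :
    (2 * m + 1 : ℝ) ^ k * n ≤ 3317760002 * 3 ^ k * ((2 * a + 1) ^ k * X) := by
  rcases hX with rfl | hX
  · simp [hn]
  · have hX0 : 1 / 2 < X := lt_of_lt_of_le (by linarith [Real.log_two_gt_d9]) hX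
    have h1 : (m : ℝ) < a + 1 := hm ▸ Nat.ceil_lt_add_one ha
    have h2 : (n : ℝ) < 3317760000 * X + 1 := hn ▸ Nat.ceil_lt_add_one (by linarith)
    calc (2 * m + 1 : ℝ) ^ k * n ≤ (3 * (2 * a + 1)) ^ k * (3317760002 * X) := by
          gcongr <;> linarith
      _ = _ := by rw [mul_pow]; ring

end Probability

end SPAM

/-! ### Choice of constants and assembly -/

theorem mainTheorem3 :
    ∃ (C₂ C₄ c₁ c₂ c₃ c₄ κ K : ℝ) (cbar₁ cbar₂ : ℝ → ℝ → ℝ → ℝ),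
      0 < C₂ ∧ 0 < C₄ ∧ 0 < c₁ ∧ 0 < c₂ ∧ 0 < c₃ ∧ 0 < c₄ ∧ 0 < κ ∧ 0 < K ∧
      (∀ L D α : ℝ, 0 < L → 0 < D → 0 < α → α ≤ 1 → 1 < cbar₁ L D α ∧ 1 < cbar₂ L D α) ∧
      ∀ (d : ℕ) (f : (Fin d → ℝ) → ℝ) (M : SPAM.BivariateSPAM d) (L α D₁ D₂ ε : ℝ)
        (A : SPAM.Inputs d) (η : A.Noise),
        0 < L → 0 < α → α ≤ 1 → 0 < D₁ → 0 < D₂ → 0 ≤ ε →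
        (∀ x ∈ SPAM.cube d, f x = M.eval x) →
        M.IsHolder L α →
        M.IsIdentifiable D₁ D₂ →
        SPAM.IsHashFamily 2 A.hash →
        η.BoundedBy ε →
        SPAM.SolvesP2 (4 * ε * A.n₂) A.sparseRec₂ →
        (∀ P, SPAM.SolvesP1 (2 * ε * Real.sqrt A.n₁) (A.sparseRec₁ P)) →
        A.ε₂ = 4 * C₄ * ε →
        A.ε₁ = 2 * C₂ * ε →
        ε < min (D₂ / (12 * C₄)) (D₁ / (6 * C₂)) →
        Real.sqrt 2 * (3 * L / D₂) ^ (1 / α) ≤ A.m₂ →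
        c₃ * SPAM.complexity₂ d M.S₂ ≤ A.n₂ →
        (3 * L / D₁) ^ (1 / α) ≤ A.m₁ →
        c₁ * SPAM.complexity₁ d M.S₁ M.S₂ ≤ A.n₁ →
        -- exact recovery with high probability
        ENNReal.ofReal (1 - Real.exp (-c₄ * A.n₂) - 2 * Real.exp (-c₂ * A.n₁)) ≤
            (A.law f η).toOuterMeasure {o | o.S₂ = M.S₂ ∧ o.S₁ = M.S₁} ∧
        -- the number of queries made in every run
        (∀ o ∈ (A.law f η).support, Multiset.card o.queries =
            4 * (2 * A.m₂ + 1) ^ 2 * A.n₂ * A.N + 2 * (2 * A.m₁ + 1) * A.n₁) ∧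
        -- its order of magnitude, from below and, for the smallest admissible parameters, from above
        κ * (cbar₂ L D₂ α * SPAM.complexity₂ d M.S₂ * A.N +
              cbar₁ L D₁ α * SPAM.complexity₁ d M.S₁ M.S₂) ≤
            4 * (2 * (A.m₂ : ℝ) + 1) ^ 2 * A.n₂ * A.N + 2 * (2 * (A.m₁ : ℝ) + 1) * A.n₁ ∧
        (A.m₂ = ⌈Real.sqrt 2 * (3 * L / D₂) ^ (1 / α)⌉₊ →
          A.n₂ = ⌈c₃ * SPAM.complexity₂ d M.S₂⌉₊ →
          A.m₁ = ⌈(3 * L / D₁) ^ (1 / α)⌉₊ →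
          A.n₁ = ⌈c₁ * SPAM.complexity₁ d M.S₁ M.S₂⌉₊ →
          4 * (2 * (A.m₂ : ℝ) + 1) ^ 2 * A.n₂ * A.N + 2 * (2 * (A.m₁ : ℝ) + 1) * A.n₁ ≤
            K * (cbar₂ L D₂ α * SPAM.complexity₂ d M.S₂ * A.N +
              cbar₁ L D₁ α * SPAM.complexity₁ d M.S₁ M.S₂)) := by
  refine ⟨288, 288, 3317760000, 1 / 2592, 3317760000, 1 / 2592, 1, 36 * 3317760002,
    fun L D α => 2 * (3 * L / D) ^ (1 / α) + 1,
    fun L D α => (2 * (Real.sqrt 2 * (3 * L / D) ^ (1 / α)) + 1) ^ 2,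
    by norm_num, by norm_num, by norm_num, by norm_num, by norm_num, by norm_num, by norm_num,
    by norm_num, fun L D α hL hD _ _ => ?_, ?_⟩
  · have h1 : 0 < (3 * L / D) ^ (1 / α) := by positivity
    have h2 : 0 < Real.sqrt 2 * (3 * L / D) ^ (1 / α) := by positivity
    exact ⟨by linarith, one_lt_pow₀ (by linarith) two_ne_zero⟩
  intro d f M L α D₁ D₂ ε A η hL hα _ hD₁ hD₂ hε hf hH hI hhash hη hsol₂ hsol₁ hε₂ hε₁ hεD
    hm₂ hn₂ hm₁ hn₁
  have ha₁ : 0 ≤ (3 * L / D₁) ^ (1 / α) := by positivity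
  have ha₂ : 0 ≤ Real.sqrt 2 * (3 * L / D₂) ^ (1 / α) := by positivity
  have hN : (0 : ℝ) ≤ A.N := Nat.cast_nonneg _
  have hX₂ : SPAM.complexity₂ d M.S₂ = 0 ∨ Real.log 2 ≤ SPAM.complexity₂ d M.S₂ := by
    rcases M.S₂.eq_empty_or_nonempty with h | h
    · simp [SPAM.complexity₂, h]
    · exact Or.inr (SPAM.log_two_le_complexity₂ h)
  have hX₁ : SPAM.complexity₁ d M.S₁ M.S₂ = 0 ∨ Real.log 2 ≤ SPAM.complexity₁ d M.S₁ M.S₂ := by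
    rcases M.S₁.eq_empty_or_nonempty with h | h
    · simp [SPAM.complexity₁, h]
    · exact Or.inr (SPAM.log_two_le_complexity₁ h _)
  refine ⟨?_, fun o ho => SPAM.card_queries A f η ho, ?_, fun e₁ e₂ e₃ e₄ => ?_⟩
  · have hexp : ∀ n : ℕ, Real.exp (-(1 / 2592) * n) = Real.exp (-(n / 2592)) := fun n => by
      congr 1; ring
    rw [hexp, hexp]
    have hle : Real.exp (-(A.n₂ / 2592 : ℝ)) ≤ 1 := Real.exp_le_one_iff.mpr (by
      rw [neg_nonpos]; positivity)
    have h0 := Real.exp_pos (-(A.n₂ / 2592 : ℝ))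
    have h0' := Real.exp_pos (-(A.n₁ / 2592 : ℝ))
    -- The product of the two success probabilities is at least one minus the sum of the failures,
    -- so the factor 2 in the claim is slack.
    calc _ ≤ ENNReal.ofReal
            ((1 - Real.exp (-(A.n₂ / 2592))) * (1 - Real.exp (-(A.n₁ / 2592)))) :=
          ENNReal.ofReal_le_ofReal (by nlinarith)
      _ = ENNReal.ofReal (1 - Real.exp (-(A.n₂ / 2592))) *
            ENNReal.ofReal (1 - Real.exp (-(A.n₁ / 2592))) := ENNReal.ofReal_mul (by linarith)
      _ ≤ _ := mul_le_mul_left (SPAM.ofReal_le_toOuterMeasure_isRobust₂ A M.S₂ hn₂) _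
      _ ≤ _ := by
        refine SPAM.toOuterMeasure_mul_le_toOuterMeasure_bind _ _ fun β hβ => ?_
        have hS₂ := SPAM.estimate₂_eq hf hL hα hD₂ hH hI hhash (hη.1 β) hε hsol₂ hε₂
          (hεD.trans_le (min_le_left _ _)) hm₂ hβ
        -- The type of the second-stage signs depends on the estimate, so the estimate is
        -- generalized before being replaced by `M.S₂`.
        suffices key : ∀ S, S = M.S₂ → ENNReal.ofReal (1 - Real.exp (-(A.n₁ / 2592))) ≤
            ((PMF.uniformOfFintype (A.Signs₁ (SPAM.pairVars S)ᶜ)).map fun γ =>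
              (⟨S, A.estimate₁ _ γ fun k => f (A.point₁ _ γ k) + η.η₁ β _ γ k,
                Finset.univ.val.map (A.point₂ β) + Finset.univ.val.map (A.point₁ _ γ)⟩ :
                SPAM.Inputs.Outcome d)).toOuterMeasure {o | o.S₂ = M.S₂ ∧ o.S₁ = M.S₁} from
          key _ hS₂
        rintro S rfl
        rw [PMF.toOuterMeasure_map_apply]
        refine (SPAM.ofReal_le_toOuterMeasure_isRobust₁ A M.S₁ M.S₂ hn₁).trans
          ((PMF.toOuterMeasure _).mono fun γ hγ => ⟨rfl, ?_⟩)
        exact SPAM.estimate₁_eq hf hL hα hD₁ hH hI (hη.2 β _ γ) hε (hsol₁ _) hε₁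
          (hεD.trans_le (min_le_right _ _)) hm₁ hγ
  · have h2 := SPAM.mul_le_two_mul_add_one_pow_mul 2 ha₂ hm₂ (SPAM.complexity₂_nonneg _) hn₂
    have h1 := SPAM.mul_le_two_mul_add_one_pow_mul 1 ha₁ hm₁ (SPAM.complexity₁_nonneg _ _) hn₁
    have h2' := mul_le_mul_of_nonneg_right h2 hN
    have p2 : 0 ≤ (2 * (A.m₂ : ℝ) + 1) ^ 2 * A.n₂ * A.N := by positivity
    have p1 : 0 ≤ (2 * (A.m₁ : ℝ) + 1) * A.n₁ := by positivity
    simp only [pow_one] at h1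
    linarith
  · have h2 := mul_le_mul_of_nonneg_right (SPAM.two_mul_add_one_pow_mul_le 2 ha₂ e₁ hX₂ e₂) hN
    have h1 := SPAM.two_mul_add_one_pow_mul_le 1 ha₁ e₃ hX₁ e₄
    have p1 : 0 ≤ (2 * (3 * L / D₁) ^ (1 / α) + 1) * SPAM.complexity₁ d M.S₁ M.S₂ :=
      mul_nonneg (by linarith) (SPAM.complexity₁_nonneg _ _)
    simp only [pow_one] at h1
    linarith
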